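/- Let $k$ be a field of characteristic $p>0$, let $r\ge 1$, and let $G$ be an infinitesimal group scheme over $k$ of height $\le r$: its coordinate algebra $k[G]$ is a finite dimensional commutative Hopf algebra over $k$ which is local, and $x^{p^r}=0$ for every $x$ in its maximal ideal. Let $kG$ be the group algebra of $G$, that is, the Hopf algebra dual to $k[G]$. Let $\mathbb G_{a(r)}$ be the $r$-th Frobenius kernel of the additive group, so that $k[\mathbb G_{a(r)}]=k[T]/T^{p^r}$ and $k\mathbb G_{a(r)}=k[u_0,\dots,u_{r-1}]/(u_0^p,\dots,u_{r-1}^p)$, where $u_i$ is the functional dual to $T^{p^i}$ in the basis $1,T,\dots,T^{p^r-1}$. Let $V(G)$ be the affine $k$-scheme representing the functor $A\mapsto \operatorname{Hom}_{\mathrm{gr.sch}/A}(\mathbb G_{a(r),A},G_A)$ on commutative $k$-algebras, and let $0\in V(G)$ be the point given by the trivial homomorphism over $k$. A point $v\in V(G)$ with residue field $k(v)$ gives a homomorphism $\mu_v:\mathbb G_{a(r),k(v)}\to G_{k(v)}$; put $\theta_v=\mu_{v*}(u_{r-1})\in k(v)G$, which satisfies $\theta_v^p=0$. For a finite dimensional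 $kG$-module $M$ and $v\in V(G)$, let $(a_1,\dots,a_p)$ be the Jordan type of $\theta_v$ acting on $M_{k(v)}=k(v)\otimes_k M$, i.e. $M_{k(v)}\cong\bigoplus_{i=1}^p (k(v)[t]/t^i)^{\oplus a_i}$ as a $k(v)[t]$-module with $t$ acting by $\theta_v$. The stable local Jordan type of $M$ at $v$ is $\underline{\operatorname{JType}}_M(v)=(a_1,\dots,a_{p-1})=\sum_{i=1}^{p-1}a_i[i]$. For a stable Jordan type $\underline a=\sum_{i=1}^{p-1}a_i[i]$ let $\underline a^\perp=\sum_{i=1}^{p-1}a_{p-i}[i]$ be its flip. Let $\Omega(M)$ be the kernel of the minimal projective cover $P\twoheadrightarrow M$ of $kG$-modules. Then $$\underline{\operatorname{JType}}_{\Omega(M)}(v)=\underline{\operatorname{JType}}_M(v)^\perp\qquad\text{for all } v\in V(G),\ v\neq 0.$$ -/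

import Mathlib

set_option linter.unusedSectionVars false

namespace InfinitesimalGroup

open scoped TensorProduct Polynomial
open WithConv

/-! Throughout, a finite group scheme `G` over the field `k` is given by its coordinate algebra
`A = k[G]`, a finite dimensional commutative Hopf algebra over `k`. -/

section AdditiveKernel

/-- The coordinate algebra `k[T]/T^{p^r}` of the `r`-th Frobenius kernel of the additive group. -/
def GaCoord (k : Type*) [Field k] (p r : ℕ) : Type _ :=
  AdjoinRoot (Polynomial.X ^ p ^ r : k[X])

variable (k : Type*) [Field k] (p r : ℕ)

noncomputable instance : CommRing (GaCoord k p r) :=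
  inferInstanceAs (CommRing (AdjoinRoot (Polynomial.X ^ p ^ r : k[X])))

noncomputable instance : Algebra k (GaCoord k p r) :=
  inferInstanceAs (Algebra k (AdjoinRoot (Polynomial.X ^ p ^ r : k[X])))

namespace GaCoord

/-- The coordinate function `T`. -/
noncomputable def T : GaCoord k p r := AdjoinRoot.root (Polynomial.X ^ p ^ r : k[X])

theorem T_pow : T k p r ^ p ^ r = 0 := by
  have h := AdjoinRoot.eval₂_root (Polynomial.X ^ p ^ r : k[X])
  rwa [Polynomial.eval₂_X_pow] at h

/-- The `k`-algebra map out of `k[T]/T^{p^r}` with `T ↦ x`. -/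
noncomputable def lift {B : Type*} [CommRing B] [Algebra k B] (x : B) (hx : x ^ p ^ r = 0) :
    GaCoord k p r →ₐ[k] B :=
  AdjoinRoot.liftAlgHom (Polynomial.X ^ p ^ r : k[X]) (Algebra.ofId k B) x
    (by rw [Polynomial.eval₂_X_pow, hx])

@[simp]
theorem lift_T {B : Type*} [CommRing B] [Algebra k B] (x : B) (hx : x ^ p ^ r = 0) :
    lift k p r x hx (T k p r) = x :=
  AdjoinRoot.lift_root (by
    change Polynomial.eval₂ (algebraMap k B) x _ = 0
    rw [Polynomial.eval₂_X_pow, hx])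

variable {k p r} in
@[ext]
theorem hom_ext {B : Type*} [Semiring B] [Algebra k B] {f g : GaCoord k p r →ₐ[k] B}
    (h : f (T k p r) = g (T k p r)) : f = g :=
  AdjoinRoot.algHom_ext h

/-- The functional on `k[T]/T^{p^r}` taking the coefficient of `T^j`
(zero for `j ≥ p^r`). -/
noncomputable def coeff (j : ℕ) : GaCoord k p r →ₗ[k] k :=
  Polynomial.lcoeff k j ∘ₗ AdjoinRoot.modByMonicHom (Polynomial.monic_X_pow (p ^ r))

theorem coeff_T_pow (i j : ℕ) :
    coeff k p r j (T k p r ^ i) = if i = j ∧ j < p ^ r then 1 else 0 := by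
  by_cases hi : i < p ^ r
  · have : AdjoinRoot.modByMonicHom (Polynomial.monic_X_pow (R := k) (p ^ r)) (T k p r ^ i) =
        Polynomial.X ^ i := by
      have h1 : T k p r ^ i = AdjoinRoot.mk (Polynomial.X ^ p ^ r : k[X]) (Polynomial.X ^ i) := by
        rw [map_pow, AdjoinRoot.mk_X]; rfl
      rw [h1, AdjoinRoot.modByMonicHom_mk,
        Polynomial.modByMonic_eq_self_iff (Polynomial.monic_X_pow _)]
      rw [Polynomial.degree_X_pow, Polynomial.degree_X_pow]
      exact_mod_cast hi
    change (AdjoinRoot.modByMonicHom (Polynomial.monic_X_pow (R := k) (p ^ r)) (T k p r ^ i)).coeff j = _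
    rw [this, Polynomial.coeff_X_pow]
    grind
  · have : T k p r ^ i = 0 := pow_eq_zero_of_le (not_lt.1 hi) (T_pow k p r)
    rw [this, map_zero]; grind

theorem sum_coeff (y : GaCoord k p r) :
    ∑ j ∈ Finset.range (p ^ r), coeff k p r j y • T k p r ^ j = y := by
  have h := AdjoinRoot.mk_leftInverse (Polynomial.monic_X_pow (R := k) (p ^ r)) y
  have hd : (AdjoinRoot.modByMonicHom (Polynomial.monic_X_pow (R := k) (p ^ r)) y).natDegree
      < p ^ r ∨ AdjoinRoot.modByMonicHom (Polynomial.monic_X_pow (R := k) (p ^ r)) y = 0 := by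
    obtain ⟨f, rfl⟩ := AdjoinRoot.mk_surjective (g := (Polynomial.X ^ p ^ r : k[X])) y
    rw [AdjoinRoot.modByMonicHom_mk]
    by_cases h0 : f %ₘ (Polynomial.X ^ p ^ r : k[X]) = 0
    · exact Or.inr h0
    · left
      have := Polynomial.degree_modByMonic_lt f (Polynomial.monic_X_pow (R := k) (p ^ r))
      rw [Polynomial.degree_X_pow] at this
      exact (Polynomial.natDegree_lt_iff_degree_lt h0).2 this
  conv_rhs => rw [← h]
  rcases hd with hd | hd
  · rw [Polynomial.as_sum_range' _ _ hd, map_sum]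
    refine Finset.sum_congr rfl fun j _ => ?_
    rw [← Polynomial.C_mul_X_pow_eq_monomial, map_mul, map_pow, AdjoinRoot.mk_X, AdjoinRoot.mk_C,
      Algebra.smul_def]
    rfl
  · have hc : ∀ j, coeff k p r j y = 0 := fun j => by
      change (AdjoinRoot.modByMonicHom (Polynomial.monic_X_pow (R := k) (p ^ r)) y).coeff j = 0
      rw [hd]; simp
    rw [hd, map_zero]
    simp only [hc, zero_smul, Finset.sum_const_zero]
    rfl

variable [Fact p.Prime] [CharP k p]

theorem add_pow_eq_zero {B : Type*} [CommRing B] [Algebra k B] {x y : B}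
    (hx : x ^ p ^ r = 0) (hy : y ^ p ^ r = 0) : (x + y) ^ p ^ r = 0 := by
  obtain ⟨s, hs⟩ := exists_add_pow_prime_pow_eq (Fact.out : p.Prime) x y r
  have hp : (p : B) = 0 := by
    rw [← map_natCast (algebraMap k B), CharP.cast_eq_zero, map_zero]
  rw [hs, hx, hy, hp]; simp

/-- The comultiplication `T ↦ T ⊗ 1 + 1 ⊗ T`. -/
noncomputable def comulHom : GaCoord k p r →ₐ[k] GaCoord k p r ⊗[k] GaCoord k p r :=
  lift k p r (T k p r ⊗ₜ[k] 1 + 1 ⊗ₜ[k] T k p r)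
    (add_pow_eq_zero k p r
      (by rw [Algebra.TensorProduct.tmul_pow, T_pow, TensorProduct.zero_tmul])
      (by rw [Algebra.TensorProduct.tmul_pow, T_pow, TensorProduct.tmul_zero]))

@[simp]
theorem comulHom_T : comulHom k p r (T k p r) = T k p r ⊗ₜ[k] 1 + 1 ⊗ₜ[k] T k p r :=
  lift_T k p r _ (add_pow_eq_zero k p r
      (by rw [Algebra.TensorProduct.tmul_pow, T_pow, TensorProduct.zero_tmul])
      (by rw [Algebra.TensorProduct.tmul_pow, T_pow, TensorProduct.tmul_zero]))

/-- The counit `T ↦ 0`. -/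
noncomputable def counitHom : GaCoord k p r →ₐ[k] k :=
  lift k p r 0 (zero_pow (pow_ne_zero r (Fact.out : p.Prime).ne_zero))

@[simp]
theorem counitHom_T : counitHom k p r (T k p r) = 0 :=
  lift_T k p r _ (zero_pow (pow_ne_zero r (Fact.out : p.Prime).ne_zero))

/-- The antipode `T ↦ -T`. -/
noncomputable def antipodeHom : GaCoord k p r →ₐ[k] GaCoord k p r :=
  lift k p r (-T k p r) (by rw [neg_pow, T_pow, mul_zero])

@[simp]
theorem antipodeHom_T : antipodeHom k p r (T k p r) = -T k p r :=
  lift_T k p r _ (by rw [neg_pow, T_pow, mul_zero])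

/-- The group structure of the Frobenius kernel: `T` is primitive. -/
noncomputable instance : Bialgebra k (GaCoord k p r) :=
  Bialgebra.ofAlgHom (comulHom k p r) (counitHom k p r)
    (by ext; simp [TensorProduct.add_tmul, TensorProduct.tmul_add,
      Algebra.TensorProduct.one_def, add_assoc])
    (by ext; simp)
    (by ext; simp)

theorem comul_T : Coalgebra.comul (R := k) (T k p r) = T k p r ⊗ₜ[k] 1 + 1 ⊗ₜ[k] T k p r :=
  comulHom_T k p r

theorem counit_T : Coalgebra.counit (R := k) (T k p r) = 0 := counitHom_T k p r

noncomputable instance : HopfAlgebra k (GaCoord k p r) :=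
  HopfAlgebra.ofAlgHom (antipodeHom k p r)
    (by
      ext
      simp only [AlgHom.comp_apply, Bialgebra.comulAlgHom_apply, comul_T, map_add,
        Bialgebra.counitAlgHom_apply, counit_T]
      refine (congrArg₂ (· + ·) (Algebra.TensorProduct.lift_tmul ..)
        (Algebra.TensorProduct.lift_tmul ..)).trans ?_
      simp)
    (by
      ext
      simp only [AlgHom.comp_apply, Bialgebra.comulAlgHom_apply, comul_T, map_add,
        Algebra.TensorProduct.lift_tmul, Bialgebra.counitAlgHom_apply, counit_T]
      simp)

end GaCoord
end AdditiveKernel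

section GroupAlgebra

/-- The group algebra `kG`, the dual of the coordinate algebra `A = k[G]` with the convolution
product `(φ * ψ)(a) = ∑ φ(a₁) ψ(a₂)`. -/
abbrev GroupAlg (k : Type*) [CommRing k] (A : Type*) [CommRing A] [Bialgebra k A] : Type _ :=
  WithConv (A →ₗ[k] k)

namespace GroupAlg

/-- The map of group algebras `KH → KG` induced by a homomorphism of group schemes `H → G` with
comorphism `f : K[G] → K[H]`. -/
noncomputable def map {K : Type*} [CommRing K] {A B : Type*} [CommRing A] [Bialgebra K A]
    [CommRing B] [Bialgebra K B] (f : A →ₐc[K] B) : GroupAlg K B →ₐ[K] GroupAlg K A :=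
  AlgHom.ofLinearMap
    { toFun := fun φ => toConv (φ.ofConv ∘ₗ (f : A →ₗ[K] B))
      map_add' := fun _ _ => rfl
      map_smul' := fun _ _ => rfl }
    (by
      ext a
      change Coalgebra.counit (R := K) (f a) = Coalgebra.counit (R := K) a
      exact CoalgHomClass.counit_comp_apply f a)
    (fun φ ψ => ofConv_injective
      (LinearMap.convMul_comp_coalgHom_distrib φ ψ (f : A →ₗc[K] B)))

@[simp]
theorem map_apply {K : Type*} [CommRing K] {A B : Type*} [CommRing A] [Bialgebra K A]
    [CommRing B] [Bialgebra K B] (f : A →ₐc[K] B) (φ : GroupAlg K B) (a : A) :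
    map f φ a = φ (f a) := rfl

variable (k K : Type*) [Field k] [CommRing K] [Algebra k K] (A : Type*) [CommRing A] [Bialgebra k A]

instance : IsScalarTower k K (GroupAlg K (K ⊗[k] A)) :=
  ⟨fun x y φ => ofConv_injective (smul_assoc x y φ.ofConv)⟩

theorem baseChange_mul_aux (φ ψ : A →ₗ[k] k) (z : A ⊗[k] A) :
    LinearMap.mul' k k (TensorProduct.map φ ψ z) • (1 : K) =
      LinearMap.mul' K K (TensorProduct.map (Module.Dual.baseChange K φ)
        (Module.Dual.baseChange K ψ)
        (TensorProduct.AlgebraTensorModule.tensorTensorTensorComm k K k K K K A A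
          ((1 ⊗ₜ[K] 1) ⊗ₜ[k] z))) := by
  induction z with
  | zero => simp
  | add x y hx hy => simp only [map_add, add_smul, TensorProduct.tmul_add, hx, hy]
  | tmul x y =>
    rw [TensorProduct.AlgebraTensorModule.tensorTensorTensorComm_tmul]
    simp [Algebra.smul_def]

/-- The base change of functionals `kG → KG`, which is a homomorphism of `k`-algebras. -/
noncomputable def baseChangeHom : GroupAlg k A →ₐ[k] GroupAlg K (K ⊗[k] A) :=
  AlgHom.ofLinearMap
    { toFun := fun φ => toConv (Module.Dual.baseChange K φ.ofConv)
      map_add' := fun φ ψ => by rw [ofConv_add, map_add, toConv_add]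
      map_smul' := fun c φ => by rw [ofConv_smul, map_smul, toConv_smul]; rfl }
    (by
      apply ofConv_injective
      ext a
      simp [Algebra.smul_def])
    (fun φ ψ => by
      apply ofConv_injective
      ext a
      simp only [LinearMap.coe_mk, AddHom.coe_mk, LinearMap.convMul_def,
        TensorProduct.AlgebraTensorModule.curry_apply, LinearMap.restrictScalars_self,
        TensorProduct.curry_apply, Module.Dual.baseChange_apply_tmul, LinearMap.comp_apply,
        TensorProduct.comul_tmul, CommSemiring.comul_apply]
      exact baseChange_mul_aux k K A φ.ofConv ψ.ofConv _)

@[simp]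
theorem baseChangeHom_apply_tmul (φ : GroupAlg k A) (x : K) (a : A) :
    baseChangeHom k K A φ (x ⊗ₜ a) = φ a • x :=
  Module.Dual.baseChange_apply_tmul K φ.ofConv x a

/-- The canonical map `K ⊗ kG → KG`, where `K[G] = K ⊗ k[G]`. -/
noncomputable def ofTensor : K ⊗[k] GroupAlg k A →ₐ[K] GroupAlg K (K ⊗[k] A) :=
  Algebra.TensorProduct.lift (Algebra.ofId K _) (baseChangeHom k K A)
    (fun x φ => Algebra.commutes x _)

theorem ofTensor_tmul (x : K) (φ : GroupAlg k A) :
    ofTensor k K A (x ⊗ₜ φ) = x • baseChangeHom k K A φ :=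
  (Algebra.TensorProduct.lift_tmul ..).trans (Algebra.smul_def ..).symm

theorem ofTensor_bijective [Module.Finite k A] : Function.Bijective (ofTensor k K A) := by
  let e := (LinearEquiv.baseChange k K _ _ (WithConv.linearEquiv k (A →ₗ[k] k))).trans
    ((TensorProduct.isBaseChange k A K).toDualBaseChange.trans
      (WithConv.linearEquiv K (K ⊗[k] A →ₗ[K] K)).symm)
  have h : (ofTensor k K A).toLinearMap = e.toLinearMap := by
    apply TensorProduct.AlgebraTensorModule.curry_injective
    apply LinearMap.ext; intro x
    apply LinearMap.ext; intro φ
    apply ofConv_injective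
    apply TensorProduct.AlgebraTensorModule.curry_injective
    ext a
    have := (TensorProduct.isBaseChange k A K).toDualBaseChange_tmul x φ.ofConv a
    change (ofTensor k K A (x ⊗ₜ φ)) (1 ⊗ₜ a) =
      (TensorProduct.isBaseChange k A K).toDualBaseChange (x ⊗ₜ φ.ofConv) (1 ⊗ₜ a)
    rw [ofTensor_tmul]
    refine Eq.trans ?_ this.symm
    change x • (baseChangeHom k K A φ (1 ⊗ₜ a)) = _
    rw [baseChangeHom_apply_tmul, Algebra.smul_def (φ a)]
    simp
  have h2 : ⇑(ofTensor k K A) = e := congrArg DFunLike.coe h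
  rw [h2]; exact e.bijective

/-- The canonical isomorphism `K ⊗ kG ≃ KG`. -/
noncomputable def tensorEquiv [Module.Finite k A] :
    K ⊗[k] GroupAlg k A ≃ₐ[K] GroupAlg K (K ⊗[k] A) :=
  AlgEquiv.ofBijective (ofTensor k K A) (ofTensor_bijective k K A)

/-- The action of `KG` on `M_K = K ⊗ M` for a `kG`-module `M`: the base change of the action of
`kG` on `M`, through `KG ≃ K ⊗ kG`. -/
noncomputable def act [Module.Finite k A] (M : Type*) [AddCommGroup M] [Module k M]
    [Module (GroupAlg k A) M] [IsScalarTower k (GroupAlg k A) M] :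
    GroupAlg K (K ⊗[k] A) →ₐ[K] Module.End K (K ⊗[k] M) :=
  ((LinearMap.tensorProductEnd k K M).comp
    (Algebra.TensorProduct.map (AlgHom.id K K) (Algebra.lsmul k k M))).comp
      (tensorEquiv k K A).symm.toAlgHom

end GroupAlg
end GroupAlgebra

section OneParameter

variable (k : Type*) [Field k] (p r : ℕ) [Fact p.Prime] [CharP k p]
  (A : Type*) [CommRing A] [Bialgebra k A]

/-- One-parameter subgroups of height `r` of `G` over `B`: homomorphisms of group schemes over `B`
from the base change of the `r`-th Frobenius kernel of the additive group to `G_B`, given by their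
comorphisms `B ⊗ k[G] → B ⊗ k[T]/T^{p^r}`. -/
abbrev OneParam (B : Type*) [CommRing B] [Algebra k B] : Type _ :=
  B ⊗[k] A →ₐc[B] B ⊗[k] GaCoord k p r

/-- The trivial one-parameter subgroup. -/
noncomputable def OneParam.trivial (B : Type*) [CommRing B] [Algebra k B] : OneParam k p r A B :=
  (Bialgebra.unitBialgHom B (B ⊗[k] GaCoord k p r)).comp (Bialgebra.counitBialgHom B (B ⊗[k] A))

/-- The generic coefficients: `genCoeff j a` is the variable standing for the coefficient of `T^j` in
the image of `a ∈ k[G]` under a one-parameter subgroup. -/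
noncomputable def genCoeff (j : ℕ) : A →ₗ[k] SymmetricAlgebra k (Fin (p ^ r) → A) :=
  if h : j < p ^ r then
    SymmetricAlgebra.ι k (Fin (p ^ r) → A) ∘ₗ LinearMap.single k (fun _ => A) ⟨j, h⟩
  else 0

/-- The equations that make `a ↦ ∑ j, genCoeff j a T^j` the comorphism of a homomorphism of group
schemes: compatibility with unit, product, counit and coproduct. -/
inductive OneParamRel : SymmetricAlgebra k (Fin (p ^ r) → A) → Prop
  | one (j : ℕ) (hj : j < p ^ r) :
      OneParamRel (genCoeff k p r A j 1 - if j = 0 then 1 else 0)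
  | mul (j : ℕ) (hj : j < p ^ r) (a b : A) :
      OneParamRel (genCoeff k p r A j (a * b) -
        ∑ x ∈ Finset.HasAntidiagonal.antidiagonal j, genCoeff k p r A x.1 a * genCoeff k p r A x.2 b)
  | counit (a : A) :
      OneParamRel (genCoeff k p r A 0 a - algebraMap k _ (Coalgebra.counit (R := k) a))
  | comul (i j : ℕ) (hi : i < p ^ r) (hj : j < p ^ r) (a : A) :
      OneParamRel (((i + j).choose i : SymmetricAlgebra k (Fin (p ^ r) → A)) *
          genCoeff k p r A (i + j) a -
        LinearMap.mul' k _ (TensorProduct.map (genCoeff k p r A i) (genCoeff k p r A j)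
          (Coalgebra.comul (R := k) a)))

/-- The coordinate algebra `k[V(G)]` of the scheme `V(G)` of one-parameter subgroups of height `r`.
The universal property is `VCoord.homEquiv`. -/
abbrev VCoord : Type _ :=
  SymmetricAlgebra k (Fin (p ^ r) → A) ⧸ Ideal.span {s | OneParamRel k p r A s}

variable {k p r A} {B : Type*} [CommRing B] [Algebra k B]

namespace VCoord

/-- The coefficients of the one-parameter subgroup attached to a `B`-valued point `f` of `V(G)`. -/
noncomputable def coeff (f : VCoord k p r A →ₐ[k] B) (j : ℕ) : A →ₗ[k] B :=
  f.toLinearMap ∘ₗ (Ideal.Quotient.mkₐ k _).toLinearMap ∘ₗ genCoeff k p r A j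

variable (f : VCoord k p r A →ₐ[k] B)

theorem coeff_apply (j : ℕ) (a : A) :
    coeff f j a = f (Ideal.Quotient.mk _ (genCoeff k p r A j a)) := rfl

theorem map_rel {s : SymmetricAlgebra k (Fin (p ^ r) → A)} (hs : OneParamRel k p r A s) :
    f (Ideal.Quotient.mk _ s) = 0 := by
  have h : Ideal.Quotient.mk (Ideal.span {s | OneParamRel k p r A s}) s = 0 :=
    Ideal.Quotient.eq_zero_iff_mem.2 (Ideal.subset_span hs)
  rw [h, map_zero]

theorem coeff_of_le {j : ℕ} (hj : p ^ r ≤ j) (a : A) : coeff f j a = 0 := by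
  simp [coeff_apply, genCoeff, not_lt.2 hj]

theorem coeff_one {j : ℕ} (hj : j < p ^ r) : coeff f j 1 = if j = 0 then 1 else 0 := by
  have := map_rel f (OneParamRel.one j hj)
  rw [map_sub, map_sub, sub_eq_zero] at this
  rw [coeff_apply, this]; split_ifs <;> simp

theorem coeff_mul {j : ℕ} (hj : j < p ^ r) (a b : A) :
    coeff f j (a * b) = ∑ x ∈ Finset.HasAntidiagonal.antidiagonal j, coeff f x.1 a * coeff f x.2 b := by
  have := map_rel f (OneParamRel.mul j hj a b)
  rw [map_sub, map_sub, sub_eq_zero] at this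
  rw [coeff_apply, this]; simp [coeff_apply]

theorem coeff_counit (a : A) : coeff f 0 a = algebraMap k B (Coalgebra.counit (R := k) a) := by
  have := map_rel f (OneParamRel.counit a)
  rw [map_sub, map_sub, sub_eq_zero] at this
  rw [coeff_apply, this]
  exact f.commutes _

theorem coeff_comul {i j : ℕ} (hi : i < p ^ r) (hj : j < p ^ r) (a : A) :
    ((i + j).choose i : B) * coeff f (i + j) a =
      LinearMap.mul' k B (TensorProduct.map (coeff f i) (coeff f j)
        (Coalgebra.comul (R := k) a)) := by
  have := map_rel f (OneParamRel.comul i j hi hj a)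
  rw [map_sub, map_sub, sub_eq_zero] at this
  rw [coeff_apply]
  refine Eq.trans (by simp) (this.trans ?_)
  generalize Coalgebra.comul (R := k) a = z
  induction z with
  | zero => simp
  | add x y hx hy => simp only [map_add, hx, hy]
  | tmul x y => simp [coeff_apply]

/-- The linear map `a ↦ ∑ j, coeff f j a ⊗ T^j`. -/
noncomputable def toLin : A →ₗ[k] B ⊗[k] GaCoord k p r :=
  ∑ j ∈ Finset.range (p ^ r),
    (TensorProduct.mk k B (GaCoord k p r)).flip (GaCoord.T k p r ^ j) ∘ₗ coeff f j

theorem toLin_apply (a : A) :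
    toLin f a = ∑ j ∈ Finset.range (p ^ r), coeff f j a ⊗ₜ[k] (GaCoord.T k p r ^ j) := by
  simp [toLin]

theorem toLin_eq_aeval (a : A) :
    toLin f a = Polynomial.aeval ((1 : B) ⊗ₜ[k] GaCoord.T k p r)
      (∑ j ∈ Finset.range (p ^ r), Polynomial.monomial j (coeff f j a)) := by
  rw [toLin_apply, map_sum]
  refine Finset.sum_congr rfl fun j _ => ?_
  rw [Polynomial.aeval_monomial, Algebra.TensorProduct.tmul_pow, one_pow,
    Algebra.TensorProduct.algebraMap_apply, Algebra.TensorProduct.tmul_mul_tmul]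
  simp

theorem aeval_T_eq {P Q : B[X]} (h : ∀ j < p ^ r, P.coeff j = Q.coeff j) :
    Polynomial.aeval ((1 : B) ⊗ₜ[k] GaCoord.T k p r) P =
      Polynomial.aeval ((1 : B) ⊗ₜ[k] GaCoord.T k p r) Q := by
  rw [← sub_eq_zero, ← map_sub]
  obtain ⟨R, hR⟩ := (Polynomial.X_pow_dvd_iff (f := P - Q) (n := p ^ r)).2
    (fun d hd => by rw [Polynomial.coeff_sub, h d hd, sub_self])
  rw [hR, map_mul, map_pow, Polynomial.aeval_X, Algebra.TensorProduct.tmul_pow, GaCoord.T_pow]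
  simp

theorem coeff_sum_monomial (n i : ℕ) (c : ℕ → B) :
    (∑ j ∈ Finset.range n, Polynomial.monomial j (c j)).coeff i = if i < n then c i else 0 := by
  simp [Polynomial.finsetSum_coeff, Polynomial.coeff_monomial]

/-- The map `toLin f` as an algebra homomorphism. -/
noncomputable def toAlgHom : A →ₐ[k] B ⊗[k] GaCoord k p r :=
  AlgHom.ofLinearMap (toLin f)
    (by
      rw [toLin_eq_aeval,
        ← map_one (Polynomial.aeval (R := B) ((1 : B) ⊗ₜ[k] GaCoord.T k p r))]
      refine aeval_T_eq fun j hj => ?_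
      rw [coeff_sum_monomial, if_pos hj, coeff_one f hj, Polynomial.coeff_one])
    (fun a b => by
      rw [toLin_eq_aeval, toLin_eq_aeval, toLin_eq_aeval, ← map_mul]
      refine aeval_T_eq fun j hj => ?_
      rw [coeff_sum_monomial, if_pos hj, coeff_mul f hj, Polynomial.coeff_mul]
      refine Finset.sum_congr rfl fun x hx => ?_
      rw [Finset.HasAntidiagonal.mem_antidiagonal] at hx
      rw [coeff_sum_monomial, coeff_sum_monomial, if_pos (by omega), if_pos (by omega)])

theorem toAlgHom_apply (a : A) :
    toAlgHom f a = ∑ j ∈ Finset.range (p ^ r), coeff f j a ⊗ₜ[k] (GaCoord.T k p r ^ j) :=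
  toLin_apply f a

/-- The `B`-linear extension of `toAlgHom f`. -/
noncomputable def toBaseAlgHom : B ⊗[k] A →ₐ[B] B ⊗[k] GaCoord k p r :=
  Algebra.TensorProduct.lift (Algebra.ofId B _) (toAlgHom f) (fun _ _ => Commute.all _ _)

theorem toBaseAlgHom_one_tmul (a : A) :
    toBaseAlgHom f (1 ⊗ₜ a) = ∑ j ∈ Finset.range (p ^ r), coeff f j a ⊗ₜ[k] (GaCoord.T k p r ^ j) := by
  rw [← toAlgHom_apply]
  exact (Algebra.TensorProduct.lift_tmul ..).trans (by rw [map_one, one_mul])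


theorem counit_aux (a : A) :
    Coalgebra.counit (R := B) (toBaseAlgHom f (1 ⊗ₜ a)) =
      Coalgebra.counit (R := B) ((1 : B) ⊗ₜ[k] a) := by
  have hpos : 0 < p ^ r := pow_pos (Fact.out : p.Prime).pos r
  rw [toBaseAlgHom_one_tmul, map_sum, Finset.sum_eq_single_of_mem 0 (Finset.mem_range.2 hpos)]
  · simp [coeff_counit, Algebra.smul_def]
  · intro j _ hj
    simp [GaCoord.counit_T, hj]

theorem comul_T_pow_base (j : ℕ) :
    Coalgebra.comul (R := B) ((1 : B) ⊗ₜ[k] (GaCoord.T k p r ^ j)) =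
      ((1 ⊗ₜ[k] GaCoord.T k p r) ⊗ₜ[B] 1 + 1 ⊗ₜ[B] (1 ⊗ₜ[k] GaCoord.T k p r)) ^ j := by
  have h : (1 : B) ⊗ₜ[k] (GaCoord.T k p r ^ j) = (1 ⊗ₜ[k] GaCoord.T k p r) ^ j := by
    rw [Algebra.TensorProduct.tmul_pow, one_pow]
  rw [h, Bialgebra.comul_pow]
  congr 1
  rw [TensorProduct.comul_tmul, GaCoord.comul_T, CommSemiring.comul_apply,
    TensorProduct.tmul_add, map_add]
  rfl

theorem map_comul_aux (z : A ⊗[k] A) :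
    TensorProduct.map (toBaseAlgHom f).toLinearMap (toBaseAlgHom f).toLinearMap
      (TensorProduct.AlgebraTensorModule.tensorTensorTensorComm k B k B B B A A
          ((1 ⊗ₜ[B] 1) ⊗ₜ[k] z)) =
    ∑ i ∈ Finset.range (p ^ r), ∑ j ∈ Finset.range (p ^ r),
      LinearMap.mul' k B (TensorProduct.map (coeff f i) (coeff f j) z) •
        ((1 ⊗ₜ[k] (GaCoord.T k p r ^ i)) ⊗ₜ[B] (1 ⊗ₜ[k] (GaCoord.T k p r ^ j))) := by
  induction z with
  | zero => simp
  | add x y hx hy =>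
    simp only [map_add, TensorProduct.tmul_add, hx, hy, add_smul, Finset.sum_add_distrib]
  | tmul x y =>
    rw [TensorProduct.AlgebraTensorModule.tensorTensorTensorComm_tmul, TensorProduct.map_tmul]
    change toBaseAlgHom f (1 ⊗ₜ x) ⊗ₜ[B] toBaseAlgHom f (1 ⊗ₜ y) = _
    rw [toBaseAlgHom_one_tmul, toBaseAlgHom_one_tmul, TensorProduct.sum_tmul]
    refine Finset.sum_congr rfl fun i _ => ?_
    rw [TensorProduct.tmul_sum]
    refine Finset.sum_congr rfl fun j _ => ?_
    rw [TensorProduct.map_tmul, LinearMap.mul'_apply, mul_smul, ← TensorProduct.tmul_smul,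
      TensorProduct.smul_tmul', TensorProduct.smul_tmul', TensorProduct.smul_tmul',
      smul_eq_mul, smul_eq_mul, mul_one, mul_one]

theorem sum_binom {C : Type*} [CommRing C] [Algebra B C] (c : ℕ → B) (n : ℕ) (x y : C)
    (hc : ∀ j, n ≤ j → c j = 0) :
    ∑ j ∈ Finset.range n, c j • (x + y) ^ j =
      ∑ i ∈ Finset.range n, ∑ j ∈ Finset.range n,
        (((i + j).choose i : B) * c (i + j)) • (x ^ i * y ^ j) := by
  have h1 : ∀ j, c j • (x + y) ^ j = ∑ z ∈ Finset.HasAntidiagonal.antidiagonal j,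
      (((z.1 + z.2).choose z.1 : B) * c (z.1 + z.2)) • (x ^ z.1 * y ^ z.2) := by
    intro j
    rw [(Commute.all x y).add_pow', Finset.smul_sum]
    refine Finset.sum_congr rfl fun z hz => ?_
    rw [Finset.HasAntidiagonal.mem_antidiagonal] at hz
    rw [hz, ← Nat.cast_smul_eq_nsmul B, smul_smul, mul_comm]
  simp_rw [h1]
  rw [Finset.sum_sigma', ← Finset.sum_product']
  symm
  refine Finset.sum_bij_ne_zero (fun z _ _ => ⟨z.1 + z.2, z⟩) ?_ ?_ ?_ ?_
  · rintro ⟨i, j⟩ _ h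
    have : i + j < n := by
      by_contra hh
      exact h (by simp [hc _ (not_lt.1 hh)])
    simpa using this
  · rintro ⟨i, j⟩ _ _ ⟨i', j'⟩ _ _ h
    simp only [Sigma.mk.injEq] at h
    exact eq_of_heq h.2
  · rintro ⟨m, ⟨i, j⟩⟩ hm _
    simp only [Finset.mem_sigma, Finset.mem_range,
      Finset.HasAntidiagonal.mem_antidiagonal] at hm
    refine ⟨(i, j), by simp; omega, ?_, ?_⟩
    · assumption
    · obtain ⟨_, rfl⟩ := hm; rfl
  · intros; rfl

theorem comul_aux (a : A) :
    TensorProduct.map (toBaseAlgHom f).toLinearMap (toBaseAlgHom f).toLinearMap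
      (Coalgebra.comul (R := B) ((1 : B) ⊗ₜ[k] a)) =
      Coalgebra.comul (R := B) (toBaseAlgHom f (1 ⊗ₜ a)) := by
  rw [TensorProduct.comul_tmul, CommSemiring.comul_apply, map_comul_aux, toBaseAlgHom_one_tmul,
    map_sum]
  have h : ∀ j, Coalgebra.comul (R := B) (coeff f j a ⊗ₜ[k] (GaCoord.T k p r ^ j)) =
      coeff f j a • (((1 : B) ⊗ₜ[k] GaCoord.T k p r) ⊗ₜ[B] (1 : B ⊗[k] GaCoord k p r) +
        (1 : B ⊗[k] GaCoord k p r) ⊗ₜ[B] ((1 : B) ⊗ₜ[k] GaCoord.T k p r)) ^ j := fun j => by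
    rw [← comul_T_pow_base, ← map_smul, TensorProduct.smul_tmul', smul_eq_mul, mul_one]
  simp_rw [h]
  refine Eq.trans ?_ (sum_binom (fun j => coeff f j a) (p ^ r) _ _ ?_).symm
  · refine Finset.sum_congr rfl fun i hi => Finset.sum_congr rfl fun j hj => ?_
    rw [coeff_comul f (Finset.mem_range.1 hi) (Finset.mem_range.1 hj)]
    simp [Algebra.TensorProduct.tmul_pow]
  · exact fun j hj => coeff_of_le f hj a

/-- The one-parameter subgroup over `B` attached to a `B`-valued point `f` of `V(G)`, with comorphism
`a ↦ ∑ j, f (genCoeff j a) ⊗ T^j`. -/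
noncomputable def toOneParam : OneParam k p r A B :=
  BialgHom.ofAlgHom (toBaseAlgHom f)
    (by
      apply Algebra.TensorProduct.ext (by ext)
      ext a
      exact counit_aux f a)
    (by
      apply Algebra.TensorProduct.ext (by ext)
      ext a
      exact comul_aux f a)

theorem toOneParam_one_tmul (a : A) :
    toOneParam f (1 ⊗ₜ a) = ∑ j ∈ Finset.range (p ^ r), coeff f j a ⊗ₜ[k] (GaCoord.T k p r ^ j) :=
  toBaseAlgHom_one_tmul f a

end VCoord

theorem GaCoord.coeff_mk {j : ℕ} (hj : j < p ^ r) (f : k[X]) :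
    GaCoord.coeff k p r j (AdjoinRoot.mk (Polynomial.X ^ p ^ r : k[X]) f) = f.coeff j := by
  change (f %ₘ (Polynomial.X ^ p ^ r : k[X])).coeff j = _
  rw [Polynomial.modByMonic_eq_sub_mul_div, Polynomial.coeff_sub, Polynomial.coeff_X_pow_mul',
    if_neg (not_le.2 hj), sub_zero]

theorem GaCoord.coeff_mul {j : ℕ} (hj : j < p ^ r) (x y : GaCoord k p r) :
    coeff k p r j (x * y) =
      ∑ z ∈ Finset.HasAntidiagonal.antidiagonal j, coeff k p r z.1 x * coeff k p r z.2 y := by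
  obtain ⟨f, rfl⟩ := AdjoinRoot.mk_surjective (g := (Polynomial.X ^ p ^ r : k[X])) x
  obtain ⟨g, rfl⟩ := AdjoinRoot.mk_surjective (g := (Polynomial.X ^ p ^ r : k[X])) y
  have h : (AdjoinRoot.mk (Polynomial.X ^ p ^ r : k[X]) f : GaCoord k p r) *
    (AdjoinRoot.mk (Polynomial.X ^ p ^ r : k[X]) g : GaCoord k p r) =
      AdjoinRoot.mk (Polynomial.X ^ p ^ r : k[X]) (f * g) := (map_mul _ _ _).symm
  refine (congrArg (coeff k p r j) h).trans ?_
  rw [coeff_mk hj, Polynomial.coeff_mul]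
  refine Finset.sum_congr rfl fun z hz => ?_
  rw [Finset.HasAntidiagonal.mem_antidiagonal] at hz
  rw [coeff_mk (by omega), coeff_mk (by omega)]

theorem GaCoord.coeff_of_le {j : ℕ} (hj : p ^ r ≤ j) : coeff k p r j = 0 := by
  ext x
  rw [← sum_coeff k p r x, map_sum]
  simp [coeff_T_pow, not_lt.2 hj]

/-- The product in the group algebra of the dual basis of the `T^j`. -/
theorem GaCoord.conv_coeff (i j : ℕ) :
    (toConv (coeff k p r i) * toConv (coeff k p r j) : GroupAlg k (GaCoord k p r)) =
      ((i + j).choose i : k) • toConv (coeff k p r (i + j)) := by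
  by_cases hi : p ^ r ≤ i
  · rw [coeff_of_le hi, coeff_of_le (j := i + j) (by omega)]; simp
  by_cases hj : p ^ r ≤ j
  · rw [coeff_of_le hj, coeff_of_le (j := i + j) (by omega)]; simp
  rw [not_le] at hi hj
  apply ofConv_injective
  apply LinearMap.ext
  intro x
  rw [← sum_coeff k p r x, map_sum, map_sum]
  refine Finset.sum_congr rfl fun n hn => ?_
  rw [map_smul, map_smul]
  congr 1
  rw [ofConv_smul, LinearMap.smul_apply, ofConv_toConv, coeff_T_pow, LinearMap.convMul_apply,
    Bialgebra.comul_pow, comul_T, (Commute.all _ _).add_pow', map_sum, map_sum]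
  simp only [Algebra.TensorProduct.tmul_pow, one_pow, Algebra.TensorProduct.tmul_mul_tmul,
    mul_one, one_mul, map_nsmul, TensorProduct.map_tmul, LinearMap.mul'_apply, ofConv_toConv,
    coeff_T_pow, hi, hj, and_true]
  rw [Finset.mem_range] at hn
  by_cases h : n = i + j
  · subst h
    rw [Finset.sum_eq_single_of_mem (i, j) (by simp)]
    · simp [hn]
    · rintro ⟨a, b⟩ _ hab
      by_cases ha : a = i
      · have : b ≠ j := fun hb => hab (by rw [ha, hb])
        simp [this]
      · simp [ha]
  · rw [Finset.sum_eq_zero]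
    · simp [h]
    · rintro ⟨a, b⟩ hab
      simp only [Finset.HasAntidiagonal.mem_antidiagonal] at hab
      by_cases ha : a = i
      · have : b ≠ j := fun hb => h (by omega)
        simp [this]
      · simp [ha]

namespace OneParam

/-- The coefficient of `T^j` over `B`. -/
noncomputable def baseCoeff (B : Type*) [CommRing B] [Algebra k B] (j : ℕ) :
    B ⊗[k] GaCoord k p r →ₗ[B] B :=
  Module.Dual.baseChange B (GaCoord.coeff k p r j)

theorem baseCoeff_tmul (j : ℕ) (b : B) (x : GaCoord k p r) :
    baseCoeff B j (b ⊗ₜ x) = GaCoord.coeff k p r j x • b :=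
  Module.Dual.baseChange_apply_tmul ..

theorem sum_baseCoeff (y : B ⊗[k] GaCoord k p r) :
    ∑ j ∈ Finset.range (p ^ r), baseCoeff B j y ⊗ₜ[k] (GaCoord.T k p r ^ j) = y := by
  induction y with
  | zero => simp
  | add x y hx hy =>
    simp only [map_add, TensorProduct.add_tmul, Finset.sum_add_distrib, hx, hy]
  | tmul b x =>
    simp only [baseCoeff_tmul, TensorProduct.smul_tmul]
    rw [← TensorProduct.tmul_sum, GaCoord.sum_coeff]

theorem baseCoeff_mul {j : ℕ} (hj : j < p ^ r) (x y : B ⊗[k] GaCoord k p r) :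
    baseCoeff B j (x * y) =
      ∑ z ∈ Finset.HasAntidiagonal.antidiagonal j, baseCoeff B z.1 x * baseCoeff B z.2 y := by
  induction x with
  | zero => simp
  | add x x' hx hy => simp only [add_mul, map_add, hx, hy, Finset.sum_add_distrib]
  | tmul b x =>
    induction y with
    | zero => simp
    | add y y' hx hy => simp only [mul_add, map_add, hx, hy, Finset.sum_add_distrib]
    | tmul c y =>
      rw [Algebra.TensorProduct.tmul_mul_tmul, baseCoeff_tmul, GaCoord.coeff_mul hj,
        Finset.sum_smul]
      refine Finset.sum_congr rfl fun z _ => ?_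
      rw [baseCoeff_tmul, baseCoeff_tmul, smul_mul_smul_comm]

theorem baseCoeff_comul (i j : ℕ) (x : B ⊗[k] GaCoord k p r) :
    LinearMap.mul' B B (TensorProduct.map (baseCoeff B i) (baseCoeff B j)
      (Coalgebra.comul (R := B) x)) = ((i + j).choose i : B) * baseCoeff B (i + j) x := by
  have h := congrArg (GroupAlg.baseChangeHom k B (GaCoord k p r)) (GaCoord.conv_coeff i j)
  rw [map_mul, map_smul] at h
  refine (congrArg (fun φ : GroupAlg B (B ⊗[k] GaCoord k p r) => φ x) h).trans ?_
  change ((i + j).choose i : k) • baseCoeff B (i + j) x = _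
  rw [Algebra.smul_def, map_natCast]

variable (μ : OneParam k p r A B)

/-- The coefficients of a one-parameter subgroup. -/
noncomputable def coeff (j : ℕ) : A →ₗ[k] B :=
  (baseCoeff B j).restrictScalars k ∘ₗ (μ : B ⊗[k] A →ₗ[B] B ⊗[k] GaCoord k p r).restrictScalars k
    ∘ₗ TensorProduct.mk k B A 1

theorem coeff_apply (j : ℕ) (a : A) : coeff μ j a = baseCoeff B j (μ (1 ⊗ₜ a)) := rfl

/-- The evaluation of the generic coefficients at a one-parameter subgroup. -/
noncomputable def evalGen : SymmetricAlgebra k (Fin (p ^ r) → A) →ₐ[k] B :=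
  SymmetricAlgebra.lift (∑ i : Fin (p ^ r), coeff μ i ∘ₗ LinearMap.proj i)

theorem evalGen_genCoeff (j : ℕ) (a : A) : evalGen μ (genCoeff k p r A j a) = coeff μ j a := by
  by_cases hj : j < p ^ r
  · rw [genCoeff, dif_pos hj, LinearMap.comp_apply, evalGen, SymmetricAlgebra.lift_ι_apply,
      LinearMap.sum_apply, Finset.sum_eq_single_of_mem ⟨j, hj⟩ (Finset.mem_univ _)]
    · simp
    · intro b _ hb
      simp [Pi.single_apply, hb]
  · rw [genCoeff, dif_neg hj, coeff_apply, baseCoeff, GaCoord.coeff_of_le (not_lt.1 hj)]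
    simp

theorem comul_aux (i j : ℕ) (z : A ⊗[k] A) :
    LinearMap.mul' k B (TensorProduct.map (coeff μ i) (coeff μ j) z) =
      LinearMap.mul' B B (TensorProduct.map (baseCoeff B i) (baseCoeff B j)
        (TensorProduct.map (μ : B ⊗[k] A →ₗ[B] B ⊗[k] GaCoord k p r)
          (μ : B ⊗[k] A →ₗ[B] B ⊗[k] GaCoord k p r)
        (TensorProduct.AlgebraTensorModule.tensorTensorTensorComm k B k B B B A A
          ((1 ⊗ₜ[B] 1) ⊗ₜ[k] z)))) := by
  induction z with
  | zero => simp
  | add x y hx hy => simp only [map_add, TensorProduct.tmul_add, hx, hy]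
  | tmul x y =>
    rw [TensorProduct.AlgebraTensorModule.tensorTensorTensorComm_tmul]
    rfl

theorem evalGen_rel {s : SymmetricAlgebra k (Fin (p ^ r) → A)} (hs : OneParamRel k p r A s) :
    evalGen μ s = 0 := by
  cases hs with
  | one j hj =>
    rw [map_sub, evalGen_genCoeff, coeff_apply, ← Algebra.TensorProduct.one_def, map_one,
      Algebra.TensorProduct.one_def, baseCoeff_tmul, ← pow_zero (GaCoord.T k p r),
      GaCoord.coeff_T_pow]
    by_cases h : j = 0
    · subst h; simp [hj]
    · simp [h, Ne.symm h]
  | mul j hj a b =>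
    rw [map_sub, evalGen_genCoeff, coeff_apply, ← mul_one (1 : B),
      ← Algebra.TensorProduct.tmul_mul_tmul, map_mul, baseCoeff_mul hj, sub_eq_zero, map_sum]
    refine Finset.sum_congr rfl fun z _ => ?_
    rw [map_mul, evalGen_genCoeff, evalGen_genCoeff]; rfl
  | counit a =>
    rw [map_sub, evalGen_genCoeff, AlgHom.commutes, sub_eq_zero]
    have h := CoalgHomClass.counit_comp_apply μ ((1 : B) ⊗ₜ[k] a)
    rw [TensorProduct.counit_tmul, CommSemiring.counit_apply, ← Algebra.algebraMap_eq_smul_one] at h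
    rw [← h, coeff_apply]
    generalize μ (1 ⊗ₜ a) = y
    have h0 : ∀ x, GaCoord.coeff k p r 0 x = Coalgebra.counit (R := k) x := by
      intro x
      have hq : 0 < p ^ r := pow_pos (Fact.out : p.Prime).pos r
      rw [← GaCoord.sum_coeff k p r x, map_sum, map_sum]
      refine Finset.sum_congr rfl fun n _ => ?_
      rw [map_smul, map_smul, GaCoord.coeff_T_pow, Bialgebra.counit_pow, GaCoord.counit_T,
        zero_pow_eq]
      simp [hq]
    induction y with
    | zero => simp
    | add x y hx hy => simp only [map_add, hx, hy]
    | tmul b x => rw [baseCoeff_tmul, h0]; simp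
  | comul i j hi hj a =>
    rw [map_sub, map_mul, map_natCast, evalGen_genCoeff, coeff_apply, ← baseCoeff_comul,
      ← CoalgHomClass.map_comp_comul_apply, TensorProduct.comul_tmul, CommSemiring.comul_apply,
      sub_eq_zero]
    refine (comul_aux μ i j _).symm.trans ?_
    generalize Coalgebra.comul (R := k) a = z
    induction z with
    | zero => simp
    | add x y hx hy => simp only [map_add, hx, hy]
    | tmul x y => simp [evalGen_genCoeff]

/-- The `B`-valued point of `V(G)` given by a one-parameter subgroup over `B`. -/
noncomputable def classify : VCoord k p r A →ₐ[k] B :=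
  Ideal.Quotient.liftₐ _ (evalGen μ) (fun a ha => by
    have : Ideal.span {s | OneParamRel k p r A s} ≤ RingHom.ker (evalGen μ) :=
      Ideal.span_le.2 fun s hs => evalGen_rel μ hs
    exact this ha)

theorem classify_coeff (j : ℕ) (a : A) : VCoord.coeff (classify μ) j a = coeff μ j a := by
  rw [VCoord.coeff_apply]
  exact evalGen_genCoeff μ j a

end OneParam

/-- `V(G)` represents the functor of one-parameter subgroups of height `r` of `G`. -/
noncomputable def VCoord.homEquiv : (VCoord k p r A →ₐ[k] B) ≃ OneParam k p r A B where
  toFun := VCoord.toOneParam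
  invFun := OneParam.classify
  left_inv f := by
    apply Ideal.Quotient.algHom_ext
    apply SymmetricAlgebra.algHom_ext
    apply LinearMap.pi_ext'
    intro j
    ext a
    have h1 : OneParam.coeff (VCoord.toOneParam f) j a = VCoord.coeff f j a := by
      rw [OneParam.coeff_apply, VCoord.toOneParam_one_tmul, map_sum,
        Finset.sum_eq_single_of_mem (j : ℕ) (Finset.mem_range.2 j.2)]
      · simp [OneParam.baseCoeff_tmul, GaCoord.coeff_T_pow]
      · intro i _ hi
        simp [OneParam.baseCoeff_tmul, GaCoord.coeff_T_pow, hi]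
    have h2 := (OneParam.classify_coeff (VCoord.toOneParam f) j a).trans h1
    rw [VCoord.coeff_apply, VCoord.coeff_apply, genCoeff, dif_pos j.2] at h2
    exact h2
  right_inv μ := by
    apply BialgHom.coe_toAlgHom_injective
    apply Algebra.TensorProduct.ext (by ext)
    ext a
    change VCoord.toOneParam (OneParam.classify μ) (1 ⊗ₜ a) = μ (1 ⊗ₜ a)
    rw [VCoord.toOneParam_one_tmul]
    simp only [OneParam.classify_coeff, OneParam.coeff_apply]
    exact OneParam.sum_baseCoeff _

/-- The bijection `VCoord.homEquiv` is natural. -/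
theorem VCoord.homEquiv_comp {C : Type*} [CommRing C] [Algebra k C] (f : VCoord k p r A →ₐ[k] B)
    (g : B →ₐ[k] C) (a : A) :
    VCoord.homEquiv (g.comp f) (1 ⊗ₜ a) =
      Algebra.TensorProduct.map g (AlgHom.id k (GaCoord k p r)) (VCoord.homEquiv f (1 ⊗ₜ a)) := by
  change VCoord.toOneParam (g.comp f) (1 ⊗ₜ a) = Algebra.TensorProduct.map g
    (AlgHom.id k (GaCoord k p r)) (VCoord.toOneParam f (1 ⊗ₜ a))
  rw [VCoord.toOneParam_one_tmul, VCoord.toOneParam_one_tmul, map_sum]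
  rfl

end OneParameter

section Points

variable (k : Type*) [Field k] (p r : ℕ) [Fact p.Prime] [CharP k p]
  (A : Type*) [CommRing A] [Bialgebra k A]

/-- The points of the affine scheme `V(G)`. -/
abbrev V : Type _ := PrimeSpectrum (VCoord k p r A)

/-- The point `0 ∈ V(G)`: the `k`-rational point given by the trivial one-parameter subgroup. -/
noncomputable def V.zero : V k p r A :=
  PrimeSpectrum.comap (VCoord.homEquiv.symm (OneParam.trivial k p r A k) : VCoord k p r A →+* k) ⊥

/-- The element `u_{r-1}` of the group algebra `k[u₀, …, u_{r-1}]/(u₀^p, …, u_{r-1}^p)` of the `r`-th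
Frobenius kernel of the additive group; `u_i` is the functional dual to `T^{p^i}`. -/
noncomputable def uTop : GroupAlg k (GaCoord k p r) := toConv (GaCoord.coeff k p r (p ^ (r - 1)))

theorem uTop_pow_p : uTop k p r ^ p = 0 := by
  have h : ∀ n : ℕ, ∃ c : k, uTop k p r ^ (n + 1) =
      c • toConv (GaCoord.coeff k p r ((n + 1) * p ^ (r - 1))) := by
    intro n
    induction n with
    | zero => exact ⟨1, by simp [uTop]⟩
    | succ n ih =>
      obtain ⟨c, hc⟩ := ih
      refine ⟨c * (((n + 1) * p ^ (r - 1) + p ^ (r - 1)).choose ((n + 1) * p ^ (r - 1)) : k), ?_⟩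
      rw [pow_succ, hc, uTop, smul_mul_assoc, GaCoord.conv_coeff, smul_smul, ← Nat.succ_mul]
  have hp := (Fact.out : p.Prime).pos
  obtain ⟨c, hc⟩ := h (p - 1)
  rw [Nat.sub_add_cancel hp] at hc
  have hle : p ^ r ≤ p * p ^ (r - 1) := by
    rw [← pow_succ']
    exact Nat.pow_le_pow_right hp (by omega)
  rw [hc, GaCoord.coeff_of_le hle]
  simp

variable {k p r A}

/-- The image of `u_{r-1}` in `KG` under a one-parameter subgroup over `K`. -/
noncomputable def OneParam.theta {K : Type*} [Field K] [Algebra k K] (μ : OneParam k p r A K) :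
    GroupAlg K (K ⊗[k] A) :=
  GroupAlg.map μ (GroupAlg.baseChangeHom k K (GaCoord k p r) (uTop k p r))

theorem OneParam.theta_pow_p {K : Type*} [Field K] [Algebra k K] (μ : OneParam k p r A K) :
    μ.theta ^ p = 0 := by
  rw [OneParam.theta, ← map_pow, ← map_pow, uTop_pow_p, map_zero, map_zero]

/-- The residue field `k(v)`. -/
def V.ResidueField (v : V k p r A) : Type _ := v.asIdeal.ResidueField

noncomputable instance (v : V k p r A) : Field v.ResidueField :=
  inferInstanceAs (Field v.asIdeal.ResidueField)

noncomputable instance (v : V k p r A) : Algebra k v.ResidueField :=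
  inferInstanceAs (Algebra k v.asIdeal.ResidueField)

/-- The canonical `k(v)`-valued point `k[V(G)] → k(v)`. -/
noncomputable def V.eval (v : V k p r A) : VCoord k p r A →ₐ[k] v.ResidueField :=
  IsScalarTower.toAlgHom k (VCoord k p r A) v.asIdeal.ResidueField

/-- The one-parameter subgroup `μ_v` over `k(v)`. -/
noncomputable def V.oneParam (v : V k p r A) : OneParam k p r A v.ResidueField :=
  VCoord.homEquiv v.eval

/-- The element `θ_v = μ_{v*}(u_{r-1}) ∈ k(v)G`. -/
noncomputable def V.theta (v : V k p r A) : GroupAlg v.ResidueField (v.ResidueField ⊗[k] A) :=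
  v.oneParam.theta

variable [Module.Finite k A] (M : Type*) [AddCommGroup M] [Module k M]
    [Module (GroupAlg k A) M] [IsScalarTower k (GroupAlg k A) M]

/-- The operator `θ_v : M_{k(v)} → M_{k(v)}`. -/
noncomputable def V.thetaOp (v : V k p r A) : Module.End v.ResidueField (v.ResidueField ⊗[k] M) :=
  GroupAlg.act k v.ResidueField A M v.theta

theorem V.thetaOp_pow_p (v : V k p r A) : v.thetaOp M ^ p = 0 := by
  rw [V.thetaOp, ← map_pow, V.theta, OneParam.theta_pow_p, map_zero]

end Points

section Jordan

variable {K : Type*} [Field K]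

/-- The Jordan block `[n] = K[t]/t^n`. -/
abbrev Block (K : Type*) [Field K] (n : ℕ) : Type _ :=
  K[X] ⧸ Ideal.span {(Polynomial.X : K[X]) ^ n}

/-- `θ` has Jordan type `∑ i, a_i [i]`: the `K[t]`-module defined by `θ` is isomorphic to the direct
sum of `a_i` copies of `K[t]/t^i` over `1 ≤ i ≤ p`. The multiplicity `a_i` is stored at index
`i - 1` of `Fin p`. -/
def HasJordanType {W : Type*} [AddCommGroup W] [Module K W] {p : ℕ} (θ : Module.End K W)
    (a : Fin p → ℕ) : Prop :=
  Nonempty (Module.AEval' θ ≃ₗ[K[X]]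
    DirectSum (Σ i : Fin p, Fin (a i)) (fun x => Block K (x.1 + 1)))

theorem exists_hasJordanType {W : Type*} [AddCommGroup W] [Module K W] [Module.Finite K W] {p : ℕ}
    {θ : Module.End K W} (hθ : θ ^ p = 0) : ∃ a : Fin p → ℕ, HasJordanType θ a := by
  classical
  have hX : Irreducible (Polynomial.X : K[X]) := Polynomial.irreducible_X
  have hann : ∀ w : Module.AEval' θ, (Polynomial.X : K[X]) ^ p • w = 0 := by
    intro w
    obtain ⟨w, rfl⟩ := (Module.AEval'.of θ).surjective w
    rw [Module.AEval'.X_pow_smul_of, hθ, zero_smul, map_zero]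
  have htor : Module.IsTorsion' (Module.AEval' θ) (Submonoid.powers (Polynomial.X : K[X])) :=
    fun {w} => ⟨⟨Polynomial.X ^ p, p, rfl⟩, hann w⟩
  obtain ⟨d, n, ⟨e⟩⟩ := Module.torsion_by_prime_power_decomposition hX htor
  have hn : ∀ i, n i ≤ p := by
    intro i
    have h1 : (Polynomial.X : K[X]) ^ p • (DirectSum.lof K[X] (Fin d)
        (fun i : Fin d => K[X] ⧸ Submodule.span K[X] {(Polynomial.X : K[X]) ^ n i}) i
          (Submodule.Quotient.mk 1)) = 0 := by
      apply e.symm.injective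
      rw [map_smul, hann, map_zero]
    rw [← map_smul, ← Submodule.Quotient.mk_smul] at h1
    have h2 := (map_eq_zero_iff _ (DirectSum.of_injective
      (β := fun i : Fin d => K[X] ⧸ Submodule.span K[X] {(Polynomial.X : K[X]) ^ n i}) i)).1 h1
    rw [Submodule.Quotient.mk_eq_zero, smul_eq_mul, mul_one, Ideal.submodule_span_eq,
      Ideal.mem_span_singleton] at h2
    exact (pow_dvd_pow_iff hX.ne_zero hX.not_isUnit).1 h2
  let a : Fin p → ℕ := fun s => Fintype.card {i : Fin d // n i = s + 1}
  let S : Type := {i : Fin d // n i ≠ 0}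
  let g : S → Fin p := fun i => ⟨n i.1 - 1, by have := hn i.1; have := i.2; omega⟩
  have hg : ∀ (i : S), n i.1 = g i + 1 := fun i => by
    have := i.2
    change n i.1 = n i.1 - 1 + 1
    omega
  let E : (Σ s : Fin p, Fin (a s)) ≃ S :=
    (Equiv.sigmaCongrRight fun s : Fin p =>
      ((Fintype.equivFin {i : Fin d // n i = s + 1}).symm.trans
        (show {i : Fin d // n i = s + 1} ≃ {i : S // g i = s} from
          { toFun := fun i => ⟨⟨i.1, by have := i.2; omega⟩, by
              have := i.2; apply Fin.ext; change n i.1 - 1 = s; omega⟩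
            invFun := fun i => ⟨i.1.1, by rw [hg, i.2]⟩
            left_inv := fun _ => rfl
            right_inv := fun _ => rfl }))).trans (Equiv.sigmaFiberEquiv g)
  have hE : ∀ x, n (E x).1 = x.1 + 1 := by
    intro x
    have h : g (E x) = x.1 := by
      obtain ⟨s, x⟩ := x
      exact (show {i : S // g i = s} from _).2
    rw [hg, h]
  let M : Fin d → Type _ := fun i => K[X] ⧸ Submodule.span K[X] {(Polynomial.X : K[X]) ^ n i}
  let R : ((i : Fin d) → M i) →ₗ[K[X]] ((i : S) → M i.1) :=
    LinearMap.pi fun i => LinearMap.proj i.1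
  have hR : Function.Bijective R := by
    constructor
    · intro f f' hff
      funext i
      by_cases hi : n i = 0
      · have : Subsingleton (M i) := by
          refine Submodule.Quotient.subsingleton_iff.2 ?_
          rw [hi, pow_zero]
          exact Ideal.span_singleton_one
        exact Subsingleton.elim _ _
      · exact congrFun hff (⟨i, hi⟩ : S)
    · intro f
      refine ⟨fun i => if h : n i ≠ 0 then f ⟨i, h⟩ else 0, ?_⟩
      funext i
      exact dif_pos i.2
  refine ⟨a, ⟨e.trans ((DirectSum.linearEquivFunOnFintype K[X] (Fin d) M).trans
    ((LinearEquiv.ofBijective R hR).trans ((LinearEquiv.piCongrLeft' K[X]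
      (fun i : S => M i.1) E.symm).trans ((LinearEquiv.piCongrRight fun x =>
        Submodule.quotEquivOfEq _ _ ?_).trans
          (DirectSum.linearEquivFunOnFintype K[X] _ _).symm))))⟩⟩
  rw [Ideal.submodule_span_eq, ← hE x]
  rfl

theorem finrank_block (n : ℕ) : Module.finrank K (Block K n) = n := by
  have := (AdjoinRoot.powerBasis' (Polynomial.monic_X_pow (R := K) n)).finrank
  rwa [AdjoinRoot.powerBasis'_dim, Polynomial.natDegree_X_pow] at this

instance (n : ℕ) : Module.Finite K (Block K n) :=
  (Polynomial.monic_X_pow (R := K) n).finite_adjoinRoot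

theorem exists_blockMul (n j : ℕ) : ∃ m : Block K (n - j) →ₗ[K[X]] Block K n,
    Function.Injective m ∧ ∀ y : Block K n, (∃ x, m x = y) ↔
      ∃ z : Block K n, (Polynomial.X : K[X]) ^ j • z = y := by
  have key : ∀ f : K[X], f ∈ Ideal.span {(Polynomial.X : K[X]) ^ (n - j)} ↔
      Polynomial.X ^ j * f ∈ Ideal.span {(Polynomial.X : K[X]) ^ n} := by
    intro f
    rw [Ideal.mem_span_singleton, Ideal.mem_span_singleton]
    rcases le_total j n with h | h
    · obtain ⟨c, rfl⟩ := Nat.exists_eq_add_of_le h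
      rw [Nat.add_sub_cancel_left, pow_add,
        mul_dvd_mul_iff_left (pow_ne_zero j Polynomial.X_ne_zero)]
    · rw [Nat.sub_eq_zero_of_le h, pow_zero]
      exact iff_of_true (one_dvd _) (Dvd.dvd.mul_right (pow_dvd_pow _ h) _)
  let L : K[X] →ₗ[K[X]] Block K n :=
    (Submodule.mkQ (Ideal.span {(Polynomial.X : K[X]) ^ n})) ∘ₗ
      LinearMap.mulLeft K[X] ((Polynomial.X : K[X]) ^ j)
  have hker : LinearMap.ker L = Ideal.span {(Polynomial.X : K[X]) ^ (n - j)} := by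
    ext f
    rw [key, LinearMap.mem_ker]
    exact Submodule.Quotient.mk_eq_zero _
  refine ⟨Submodule.liftQ _ L hker.ge, ?_, ?_⟩
  · rw [← LinearMap.ker_eq_bot]
    exact Submodule.ker_liftQ_eq_bot _ _ _ hker.le
  · intro y
    constructor
    · rintro ⟨x, rfl⟩
      obtain ⟨f, rfl⟩ := Submodule.Quotient.mk_surjective _ x
      exact ⟨Submodule.Quotient.mk f, rfl⟩
    · rintro ⟨z, rfl⟩
      obtain ⟨f, rfl⟩ := Submodule.Quotient.mk_surjective _ z
      exact ⟨Submodule.Quotient.mk f, rfl⟩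

theorem HasJordanType.finrank_range {W : Type*} [AddCommGroup W] [Module K W] {p : ℕ}
    {θ : Module.End K W} {a : Fin p → ℕ} (h : HasJordanType θ a) (j : ℕ) :
    Module.finrank K (LinearMap.range (θ ^ j)) = ∑ s : Fin p, a s * (s + 1 - j) := by
  classical
  obtain ⟨e⟩ := h
  let P := (x : Σ i : Fin p, Fin (a i)) → Block K (x.1 + 1)
  let e' : Module.AEval' θ ≃ₗ[K[X]] P := e.trans (DirectSum.linearEquivFunOnFintype K[X] _ _)
  choose m hm hr using fun x : Σ i : Fin p, Fin (a i) => exists_blockMul (K := K) (x.1 + 1) j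
  let Φ : ((x : Σ i : Fin p, Fin (a i)) → Block K (x.1 + 1 - j)) →ₗ[K[X]] P :=
    LinearMap.pi fun x => m x ∘ₗ LinearMap.proj x
  have hΦ : Function.Injective Φ := fun f g hfg => funext fun x => hm x (congrFun hfg x)
  let Ψ : ((x : Σ i : Fin p, Fin (a i)) → Block K (x.1 + 1 - j)) →ₗ[K] W :=
    (Module.AEval'.of θ).symm.toLinearMap ∘ₗ (e'.symm.toLinearMap ∘ₗ Φ).restrictScalars K
  have hΨ : Function.Injective Ψ :=
    (Module.AEval'.of θ).symm.injective.comp (e'.symm.injective.comp hΦ)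
  have hrange : LinearMap.range Ψ = LinearMap.range (θ ^ j) := by
    ext w
    constructor
    · rintro ⟨f, rfl⟩
      have : ∀ x, ∃ z, (Polynomial.X : K[X]) ^ j • z = m x (f x) := fun x => (hr x _).1 ⟨_, rfl⟩
      choose z hz using this
      refine ⟨(Module.AEval'.of θ).symm (e'.symm z), ?_⟩
      have h1 : Φ f = (Polynomial.X : K[X]) ^ j • z := funext fun x => (hz x).symm
      change _ = (Module.AEval'.of θ).symm (e'.symm (Φ f))
      rw [h1, map_smul]
      apply (Module.AEval'.of θ).injective
      rw [LinearEquiv.apply_symm_apply, ← Module.End.smul_def, ← Module.AEval'.X_pow_smul_of,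
        LinearEquiv.apply_symm_apply]
    · rintro ⟨w, rfl⟩
      have : ∀ x, ∃ y, m x y = (Polynomial.X : K[X]) ^ j • (e' (Module.AEval'.of θ w)) x :=
        fun x => (hr x _).2 ⟨_, rfl⟩
      choose y hy using this
      refine ⟨y, ?_⟩
      change (Module.AEval'.of θ).symm (e'.symm (Φ y)) = _
      have h1 : Φ y = (Polynomial.X : K[X]) ^ j • e' (Module.AEval'.of θ w) := funext hy
      rw [h1, map_smul, LinearEquiv.symm_apply_apply, Module.AEval'.X_pow_smul_of,
        LinearEquiv.symm_apply_apply, Module.End.smul_def]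
  rw [← hrange, LinearMap.finrank_range_of_inj hΨ, Module.finrank_pi_fintype]
  simp only [finrank_block]
  rw [Fintype.sum_sigma]
  simp

theorem HasJordanType.unique {W : Type*} [AddCommGroup W] [Module K W] {p : ℕ}
    {θ : Module.End K W} {a b : Fin p → ℕ} (ha : HasJordanType θ a) (hb : HasJordanType θ b) :
    a = b := by
  have h : ∀ j, ∑ s : Fin p, a s * (s + 1 - j) = ∑ s : Fin p, b s * (s + 1 - j) := fun j => by
    rw [← ha.finrank_range, ← hb.finrank_range]
  have key : ∀ (c : Fin p → ℕ) (i : Fin p), c i + 2 * ∑ s : Fin p, c s * (s + 1 - (i + 1)) =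
      ∑ s : Fin p, c s * (s + 1 - i) + ∑ s : Fin p, c s * (s + 1 - (i + 2)) := by
    intro c i
    have h1 : c i = ∑ s : Fin p, c s * (if s = i then 1 else 0) := by simp
    conv_lhs => rw [h1]
    rw [Finset.mul_sum, ← Finset.sum_add_distrib, ← Finset.sum_add_distrib]
    refine Finset.sum_congr rfl fun s _ => ?_
    have h2 : (if s = i then 1 else 0) + 2 * ((s : ℕ) + 1 - (i + 1)) =
        ((s : ℕ) + 1 - i) + ((s : ℕ) + 1 - (i + 2)) := by
      split_ifs with hsi
      · subst hsi; omega
      · have : (s : ℕ) ≠ i := fun hh => hsi (Fin.ext hh)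
        omega
    rw [← mul_add, ← h2]; ring
  funext i
  have h1 := key a i
  have h2 := key b i
  rw [h, h, h] at h1
  omega

/-- The Jordan type `(a₁, …, a_p)` of a `p`-nilpotent operator `θ` on a finite dimensional space:
the unique `a` with `HasJordanType θ a`, see `hasJordanType_jordanType` and
`HasJordanType.jordanType_eq` (and `0` if there is no such `a`). -/
noncomputable def jordanType {W : Type*} [AddCommGroup W] [Module K W] (p : ℕ)
    (θ : Module.End K W) : Fin p → ℕ :=
  open scoped Classical in
  if h : ∃ a : Fin p → ℕ, HasJordanType θ a then h.choose else 0

theorem HasJordanType.jordanType_eq {W : Type*} [AddCommGroup W] [Module K W] {p : ℕ}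
    {θ : Module.End K W} {a : Fin p → ℕ} (h : HasJordanType θ a) : jordanType p θ = a := by
  have hex : ∃ a : Fin p → ℕ, HasJordanType θ a := ⟨a, h⟩
  rw [jordanType, dif_pos hex]
  exact hex.choose_spec.unique h

theorem hasJordanType_jordanType {W : Type*} [AddCommGroup W] [Module K W] [Module.Finite K W]
    {p : ℕ} {θ : Module.End K W} (hθ : θ ^ p = 0) : HasJordanType θ (jordanType p θ) := by
  obtain ⟨a, ha⟩ := exists_hasJordanType hθ
  rwa [ha.jordanType_eq]

end Jordan

section LocalJordanType

variable {k : Type*} [Field k] {p r : ℕ} [Fact p.Prime] [CharP k p]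
  {A : Type*} [CommRing A] [Bialgebra k A] [Module.Finite k A]
  (M : Type*) [AddCommGroup M] [Module k M]
  [Module (GroupAlg k A) M] [IsScalarTower k (GroupAlg k A) M]

/-- The local Jordan type `JType_M(v) = (a₁, …, a_p)` of the `kG`-module `M` at `v ∈ V(G)`: the
Jordan type of `θ_v` on `M_{k(v)}`. -/
noncomputable def localJordanType (v : V k p r A) : Fin p → ℕ :=
  jordanType p (v.thetaOp M)

theorem hasJordanType_localJordanType [Module.Finite k M] (v : V k p r A) :
    HasJordanType (v.thetaOp M) (localJordanType M v) :=
  hasJordanType_jordanType (v.thetaOp_pow_p M)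

/-- The stable local Jordan type `(a₁, …, a_{p-1})` of `M` at `v`. -/
noncomputable def stableLocalJordanType (v : V k p r A) : Fin (p - 1) → ℕ :=
  fun i => localJordanType M v (Fin.castLE (Nat.sub_le p 1) i)

end LocalJordanType

/-- The flip `(a₁, …, a_{p-1}) ↦ (a_{p-1}, …, a₁)` of a stable Jordan type. -/
def flip {p : ℕ} (a : Fin (p - 1) → ℕ) : Fin (p - 1) → ℕ :=
  fun i => a i.rev

/-- `f : P → M` is a (minimal) projective cover: `P` is projective, `f` is surjective, and no proper
submodule of `P` is mapped onto `M`. The Heller shift `Ω(M)` is then `LinearMap.ker f`. -/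
structure IsProjectiveCover {R P M : Type*} [Ring R] [AddCommGroup P] [Module R P]
    [AddCommGroup M] [Module R M] (f : P →ₗ[R] M) : Prop where
  projective : Module.Projective R P
  surjective : Function.Surjective f
  minimal : ∀ N : Submodule R P, N.map f = ⊤ → N = ⊤

end InfinitesimalGroup

namespace InfinitesimalGroup

open scoped TensorProduct Polynomial
open WithConv

/-! ### Ranks of powers of a `p`-nilpotent operator, and exact sequences with free middle term -/

section LinearAlgebra

variable {K : Type*} [Field K]

/-! Write `K` for `k(v)` and `θ` for `θ_v`. The theorem reduces to one fact: for `v ≠ 0` the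
operator `θ` acts freely on `P_K`, meaning that only blocks of size `p` occur. This is used
throughout in the form `ker θ ≤ range (θ ^ (p - 1))`.

Given freeness, base change the sequence `0 → Ω(M) → P → M → 0` to `K`. On the middle term `range (θ
^ j) = ker (θ ^ (p - j))`, so the rank of `θ ^ j` on `M_K` equals, up to terms affine in `j`, the
rank of `θ ^ (p - j)` on `Ω(M)_K` (`finrank_range_pow_of_exact`). Multiplicities are second
differences of ranks, so the affine terms disappear and blocks of size `i` correspond to blocks of
size `p - i` (`HasJordanType.eq_of_exact`).

Freeness on a projective module follows from freeness of left multiplication by `θ` on `KG`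
(`ker_act_le_of_projective`), which is the transpose of a translation operator on the coordinate
algebra `H = K ⊗ k[G]` (`exists_eq_pow_mul`). So the work takes place on `H`. The functionals dual
to the `T^n`, pushed forward along `μ_v`, act on `H` as commuting operators `D n` that form a
truncated higher derivation, and `θ` acts as `D (p ^ (r - 1))`. As `v ≠ 0`, some functional dual to
`T^{p^i}` has nonzero image in `KG` (`V.exists_dualPow_ne_zero`). Take `i` least, and `y` in the
augmentation ideal on which that functional is nonzero. The power `z = y ^ p ^ (r - 1 - i)` moves
this nonvanishing up to level `r - 1`: the value of `D (p ^ (r - 1)) z` at the identity is nonzero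
(`leibniz_pow_char_pow`). On the subring killed by all `D n` with `n` not divisible by `p ^ (r -
1)`, `θ` is an honest derivation; `z` lies there, and `θ ^ (p - 1)` takes `z ^ (p - 1)` to an
element with nonzero counit, hence to a unit because `G` is infinitesimal. A `θ`-constant unit in
the range of `θ ^ (p - 1)` gives freeness (`ker_le_range_pow_of_leibniz`). -/

theorem ker_pow_le_range_pow {W : Type*} [AddCommGroup W] [Module K W] {θ : Module.End K W} {p : ℕ}
    (h : LinearMap.ker θ ≤ LinearMap.range (θ ^ (p - 1))) {m : ℕ} (hm : m ≤ p) :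
    LinearMap.ker (θ ^ m) ≤ LinearMap.range (θ ^ (p - m)) := by
  induction m with
  | zero =>
    intro x hx
    have : x = 0 := by simpa using hx
    rw [this]; exact zero_mem _
  | succ m ih =>
    intro x hx
    have h1 : (θ ^ m) x ∈ LinearMap.ker θ := by
      rw [LinearMap.mem_ker, ← Module.End.mul_apply, ← pow_succ']; exact hx
    obtain ⟨e, he⟩ := h h1
    -- Since `θ ^ (p - 1) = θ ^ m * θ ^ (p - (m + 1))`, subtracting this element corrects `x` to one
    -- killed by a lower power.
    have h2 : x - (θ ^ (p - (m + 1))) e ∈ LinearMap.ker (θ ^ m) := by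
      rw [LinearMap.mem_ker, map_sub, ← Module.End.mul_apply, ← pow_add, ← he, sub_eq_zero]
      congr 2; omega
    obtain ⟨e', he'⟩ := ih (by omega) h2
    refine ⟨e + θ e', ?_⟩
    rw [map_add, ← Module.End.mul_apply, ← pow_succ, show p - (m + 1) + 1 = p - m by omega, he']
    abel

/-- For `j < p` the whole kernel of `θ` lies in the range of `θ ^ j`, so each further application of
`θ` loses exactly its dimension. Thus the rank is affine in `j` for `j ≤ p`. -/
theorem finrank_range_pow_eq {W : Type*} [AddCommGroup W] [Module K W] [Module.Finite K W]
    {θ : Module.End K W} {p : ℕ} (h : LinearMap.ker θ ≤ LinearMap.range (θ ^ (p - 1)))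
    {j : ℕ} (hj : j + 1 ≤ p) :
    Module.finrank K (LinearMap.range (θ ^ j)) =
      Module.finrank K (LinearMap.range (θ ^ (j + 1))) + Module.finrank K (LinearMap.ker θ) := by
  have h1 := (θ.domRestrict (LinearMap.range (θ ^ j))).finrank_range_add_finrank_ker
  rw [LinearMap.range_domRestrict, LinearMap.ker_domRestrict, ← LinearMap.range_comp,
    ← Module.End.mul_eq_comp, ← pow_succ'] at h1
  have h2 : LinearMap.ker θ ≤ LinearMap.range (θ ^ j) := by
    refine h.trans ?_
    rw [show p - 1 = j + (p - 1 - j) by omega, pow_add, Module.End.mul_eq_comp]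
    exact LinearMap.range_comp_le_range _ _
  rw [← h1, (Submodule.comapSubtypeEquivOfLe h2).finrank_eq]

theorem pow_intertwine {W W' : Type*} [AddCommGroup W] [Module K W] [AddCommGroup W'] [Module K W']
    {θ : Module.End K W} {θ' : Module.End K W'} {g : W →ₗ[K] W'} (hg : ∀ x, g (θ x) = θ' (g x))
    (n : ℕ) (x : W) : g ((θ ^ n) x) = (θ' ^ n) (g x) := by
  induction n generalizing x with
  | zero => simp
  | succ n ih => rw [pow_succ, pow_succ, Module.End.mul_apply, Module.End.mul_apply, ih, hg]

variable {W₁ W₂ W₃ : Type*} [AddCommGroup W₁] [Module K W₁] [AddCommGroup W₂] [Module K W₂]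
  [AddCommGroup W₃] [Module K W₃] [Module.Finite K W₁] [Module.Finite K W₂]
  {θ₁ : Module.End K W₁} {θ₂ : Module.End K W₂} {θ₃ : Module.End K W₃}
  {ι : W₁ →ₗ[K] W₂} {g : W₂ →ₗ[K] W₃} {p : ℕ}

/-- Rank–nullity for `g` restricted to `range (θ₂ ^ j)`. The image is `range (θ₃ ^ j)`; since `range
(θ₂ ^ j) = ker (θ₂ ^ (p - j))`, the kernel is the copy of `ker (θ₁ ^ (p - j))` inside `W₂`. -/
theorem finrank_range_pow_of_exact (hι : Function.Injective ι) (hg : Function.Surjective g)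
    (hex : Function.Exact ι g) (hιθ : ∀ x, ι (θ₁ x) = θ₂ (ι x)) (hgθ : ∀ x, g (θ₂ x) = θ₃ (g x))
    (hp : θ₂ ^ p = 0) (h : LinearMap.ker θ₂ ≤ LinearMap.range (θ₂ ^ (p - 1)))
    {j : ℕ} (hj : j ≤ p) :
    Module.finrank K (LinearMap.range (θ₃ ^ j)) + Module.finrank K W₁ =
      Module.finrank K (LinearMap.range (θ₂ ^ j)) +
        Module.finrank K (LinearMap.range (θ₁ ^ (p - j))) := by
  have h1 := (g.domRestrict (LinearMap.range (θ₂ ^ j))).finrank_range_add_finrank_ker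
  have h2 : (LinearMap.range (θ₂ ^ j)).map g = LinearMap.range (θ₃ ^ j) := by
    rw [← LinearMap.range_comp, show g ∘ₗ (θ₂ ^ j) = (θ₃ ^ j) ∘ₗ g from
      LinearMap.ext (pow_intertwine hgθ j), LinearMap.range_comp_of_range_eq_top _
      (LinearMap.range_eq_top.2 hg)]
  have h3 : LinearMap.range (θ₂ ^ j) = LinearMap.ker (θ₂ ^ (p - j)) := by
    apply le_antisymm
    · rintro _ ⟨x, rfl⟩
      rw [LinearMap.mem_ker, ← Module.End.mul_apply, ← pow_add, Nat.sub_add_cancel hj, hp]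
      rfl
    · have := ker_pow_le_range_pow h (Nat.sub_le p j)
      rwa [Nat.sub_sub_self hj] at this
  have h4 : (LinearMap.range (θ₂ ^ j)) ⊓ LinearMap.ker g =
      (LinearMap.ker (θ₁ ^ (p - j))).map ι := by
    rw [h3]
    ext x
    simp only [Submodule.mem_inf, LinearMap.mem_ker, Submodule.mem_map]
    constructor
    · rintro ⟨hx, hx'⟩
      obtain ⟨y, rfl⟩ := (hex x).1 hx'
      refine ⟨y, hι ?_, rfl⟩
      rw [pow_intertwine hιθ, hx, map_zero]
    · rintro ⟨y, hy, rfl⟩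
      exact ⟨by rw [← pow_intertwine hιθ, hy, map_zero], hex.apply_apply_eq_zero y⟩
  have h5 : Module.finrank K (LinearMap.ker (g.domRestrict (LinearMap.range (θ₂ ^ j)))) =
      Module.finrank K (LinearMap.ker (θ₁ ^ (p - j))) := by
    rw [LinearMap.ker_domRestrict, ← Submodule.finrank_map_subtype_eq,
      Submodule.map_comap_subtype, h4]
    exact (Submodule.equivMapOfInjective ι hι _).finrank_eq.symm
  have h6 := (θ₁ ^ (p - j)).finrank_range_add_finrank_ker
  rw [LinearMap.range_domRestrict, h2, h5] at h1
  omega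

/-- A block of size `s + 1` contributes the truncated difference `s + 1 - j` to the rank of `θ ^ j`.
As a function of `j` it bends only at `j = s + 1`, so the second difference centred at `i + 1` sees
only `s = i`. -/
theorem HasJordanType.multiplicity_add {W : Type*} [AddCommGroup W] [Module K W] {p : ℕ}
    {θ : Module.End K W} {a : Fin p → ℕ} (h : HasJordanType θ a) (i : Fin p) :
    a i + 2 * Module.finrank K (LinearMap.range (θ ^ ((i : ℕ) + 1))) =
      Module.finrank K (LinearMap.range (θ ^ (i : ℕ))) +
        Module.finrank K (LinearMap.range (θ ^ ((i : ℕ) + 2))) := by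
  simp only [h.finrank_range]
  have h1 : a i = ∑ s : Fin p, a s * (if s = i then 1 else 0) := by simp
  conv_lhs => rw [h1]
  rw [Finset.mul_sum, ← Finset.sum_add_distrib, ← Finset.sum_add_distrib]
  refine Finset.sum_congr rfl fun s _ => ?_
  have h2 : (if s = i then 1 else 0) + 2 * ((s : ℕ) + 1 - (i + 1)) =
      ((s : ℕ) + 1 - i) + ((s : ℕ) + 1 - (i + 2)) := by
    split_ifs with hsi
    · subst hsi; omega
    · have : (s : ℕ) ≠ i := fun hh => hsi (Fin.ext hh)
      omega
  rw [← mul_add, ← h2]; ring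

theorem HasJordanType.eq_of_exact {a₁ a₃ : Fin p → ℕ} (ha₁ : HasJordanType θ₁ a₁)
    (ha₃ : HasJordanType θ₃ a₃) (hι : Function.Injective ι) (hg : Function.Surjective g)
    (hex : Function.Exact ι g) (hιθ : ∀ x, ι (θ₁ x) = θ₂ (ι x)) (hgθ : ∀ x, g (θ₂ x) = θ₃ (g x))
    (hp : θ₂ ^ p = 0) (h : LinearMap.ker θ₂ ≤ LinearMap.range (θ₂ ^ (p - 1)))
    {i j : Fin p} (hij : (i : ℕ) + j + 2 = p) : a₁ i = a₃ j := by
  have h1 := ha₁.multiplicity_add i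
  have h3 := ha₃.multiplicity_add j
  -- Indices are block sizes minus one, so `hij` says that the sizes add to `p`. The powers `j`, `j
  -- + 1`, `j + 2` of `θ₃` meet the powers `i + 2`, `i + 1`, `i` of `θ₁`, and `d0`, `d1` make the
  -- second difference for `θ₂` vanish.
  have e0 := finrank_range_pow_of_exact hι hg hex hιθ hgθ hp h (j := j) (by omega)
  have e1 := finrank_range_pow_of_exact hι hg hex hιθ hgθ hp h (j := j + 1) (by omega)
  have e2 := finrank_range_pow_of_exact hι hg hex hιθ hgθ hp h (j := j + 2) (by omega)
  have d0 := finrank_range_pow_eq h (j := j) (by omega)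
  have d1 := finrank_range_pow_eq h (j := j + 1) (by omega)
  rw [show p - (j : ℕ) = i + 2 by omega] at e0
  rw [show p - ((j : ℕ) + 1) = i + 1 by omega] at e1
  rw [show p - ((j : ℕ) + 2) = i by omega] at e2
  rw [show (j : ℕ) + 1 + 1 = j + 2 by omega] at d1
  omega

end LinearAlgebra

/-! ### Higher derivations in characteristic `p` and a freeness criterion -/

section HigherDerivation

/-- A system of maps satisfying the Leibniz rule below `N` takes `x ^ p ^ m` to the `p ^ m`-th powers
of its values at `x`. -/
theorem leibniz_pow_char_pow {R S : Type*} [CommRing R] [CommRing S] (p : ℕ) [Fact p.Prime]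
    [CharP R p] {N : ℕ} (D : ℕ → S → R) (h1 : ∀ n < N, D n 1 = if n = 0 then 1 else 0)
    (hD : ∀ n < N, ∀ x y, D n (x * y) =
      ∑ z ∈ Finset.HasAntidiagonal.antidiagonal n, D z.1 x * D z.2 y)
    (x : S) (m : ℕ) {n : ℕ} (hn : n < N) :
    D n (x ^ p ^ m) = if p ^ m ∣ n then D (n / p ^ m) x ^ p ^ m else 0 := by
  -- The truncated generating polynomial of the `D j x`. The Leibniz rule makes `x ↦ Φ`
  -- multiplicative modulo `X ^ N`, and the `p ^ m`-th power of a polynomial is its Frobenius twist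
  -- with exponents multiplied by `p ^ m`.
  let Φ : R[X] := ∑ j ∈ Finset.range N, Polynomial.monomial j (D j x)
  have hΦ : ∀ j < N, Φ.coeff j = D j x := fun j hj => by
    rw [VCoord.coeff_sum_monomial, if_pos hj]
  have hpow : ∀ s, ∀ j < N, D j (x ^ s) = (Φ ^ s).coeff j := by
    intro s
    induction s with
    | zero => intro j hj; rw [pow_zero, pow_zero, h1 j hj, Polynomial.coeff_one]
    | succ s ih =>
      intro j hj
      rw [pow_succ, pow_succ, hD j hj, Polynomial.coeff_mul]
      refine Finset.sum_congr rfl fun z hz => ?_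
      rw [Finset.HasAntidiagonal.mem_antidiagonal] at hz
      rw [ih _ (by omega), hΦ _ (by omega)]
  have hpp : 0 < p ^ m := pow_pos (Fact.out : p.Prime).pos m
  rw [hpow _ n hn, ← Polynomial.map_iterateFrobenius_expand, Polynomial.coeff_map,
    Polynomial.coeff_expand hpp]
  split_ifs with h
  · rw [hΦ _ ((Nat.div_le_self _ _).trans_lt hn), iterateFrobenius_def]
  · exact map_zero _

/-- Lucas's theorem, removing one zero digit in base `p` from both entries at each step. -/
theorem choose_mul_pow_modEq (p : ℕ) [Fact p.Prime] (i m : ℕ) :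
    (p ^ i * m).choose (p ^ i) ≡ m [MOD p] := by
  have hp := (Fact.out : p.Prime).pos
  induction i with
  | zero => simp [Nat.ModEq]
  | succ i ih =>
    have h := Choose.choose_modEq_choose_mod_mul_choose_div_nat
      (p := p) (n := p ^ (i + 1) * m) (k := p ^ (i + 1))
    rw [pow_succ', mul_assoc, Nat.mul_mod_right, Nat.mul_mod_right, Nat.mul_div_cancel_left _ hp,
      Nat.mul_div_cancel_left _ hp, Nat.choose_self, one_mul] at h
    rw [pow_succ', mul_assoc]
    exact h.trans ih

/-- If `D` satisfies the Leibniz rule against the elements of the subring `C`, and `D z` is not in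
the kernel of `ε`, then `D` is free as a `p`-nilpotent operator. -/
theorem ker_le_range_pow_of_leibniz {K H : Type*} [Field K] [CommRing H] [Algebra K H] (p : ℕ)
    [Fact p.Prime] [CharP K p] (ε : H →ₐ[K] K) (hε : ∀ x, ε x ≠ 0 → IsUnit x)
    (D : Module.End K H) (hDp : D ^ p = 0) (C : Subring H) (hC : ∀ x ∈ C, D x ∈ C)
    (hD : ∀ b, ∀ x ∈ C, D (b * x) = D b * x + b * D x) {z : H} (hz : z ∈ C) (hz0 : ε z = 0)
    (hz1 : ε (D z) ≠ 0) : LinearMap.ker D ≤ LinearMap.range (D ^ (p - 1)) := by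
  have hp := (Fact.out : p.Prime).pos
  have hpowC : ∀ n, ∀ x ∈ C, (D ^ n) x ∈ C := by
    intro n
    induction n with
    | zero => intro x hx; simpa using hx
    | succ n ih =>
      intro x hx
      rw [pow_succ', Module.End.mul_apply]
      exact hC _ (ih x hx)
  have hDz : ∀ n, D (z ^ (n + 1)) = (n + 1 : ℕ) • (z ^ n * D z) := by
    intro n
    induction n with
    | zero => simp
    | succ n ih =>
      rw [pow_succ, hD _ _ hz, ih, succ_nsmul (_) (n + 1), smul_mul_assoc]
      congr 2
      ring
  -- The factor `w` is needed for the induction: `D (z ^ (n + 1) * w)` is `z ^ n` times `(n + 1) * D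
  -- z * w + z * D w`, again of the required form, and its second summand contributes zero because
  -- `ε z = 0`.
  have key : ∀ n, ∀ w ∈ C, ε ((D ^ n) (z ^ n * w)) = (n.factorial : K) * ε (D z) ^ n * ε w := by
    intro n
    induction n with
    | zero => intro w _; simp
    | succ n ih =>
      intro w hw
      rw [pow_succ, Module.End.mul_apply, hD _ _ hw, hDz, map_add, map_add, smul_mul_assoc,
        map_nsmul, map_nsmul, mul_assoc, pow_succ z, mul_assoc _ z,
        ih _ (C.mul_mem (hC _ hz) hw), ih _ (C.mul_mem hz (hC _ hw)), map_mul, map_mul, hz0,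
        Nat.factorial_succ, nsmul_eq_mul]
      push_cast
      ring
  set a := (D ^ (p - 1)) (z ^ (p - 1)) with ha
  have haC : a ∈ C := hpowC _ _ (C.pow_mem hz _)
  have haε : ε a ≠ 0 := by
    have := key (p - 1) 1 C.one_mem
    rw [mul_one, map_one, mul_one] at this
    rw [ha, this]
    refine mul_ne_zero ?_ (pow_ne_zero _ hz1)
    -- The factorial is `(p - 1)!`, which is nonzero in characteristic `p`.
    rw [Ne, CharP.cast_eq_zero_iff K p, (Fact.out : p.Prime).dvd_factorial]
    omega
  have hDa : D a = 0 := by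
    rw [ha, ← Module.End.mul_apply, ← pow_succ', Nat.sub_add_cancel hp, hDp]; rfl
  obtain ⟨u, hu⟩ := hε a haε
  have hlin : ∀ c, D c = 0 → ∀ n, ∀ x ∈ C, (D ^ n) (c * x) = c * (D ^ n) x := by
    intro c hc n
    induction n with
    | zero => intro x _; simp
    | succ n ih =>
      intro x hx
      rw [pow_succ, Module.End.mul_apply, hD _ _ hx, hc, zero_mul, zero_add, ih _ (hC _ hx),
        Module.End.mul_apply]
  intro c hc
  rw [LinearMap.mem_ker] at hc
  -- The Leibniz rule is available only against `C`, so it is applied to `c = (c * a⁻¹) * a` with `a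
  -- ∈ C` and `D a = 0`; nothing is needed about `a⁻¹` itself.
  have hc' : D (c * ↑u⁻¹) = 0 := by
    have := hD (c * ↑u⁻¹) a haC
    rw [← hu, mul_assoc, Units.inv_mul, mul_one, hc, hu, hDa, mul_zero, add_zero, ← hu] at this
    exact (Units.mul_left_eq_zero u).1 this.symm
  -- `D` is linear over the constant `c * a⁻¹` on `C`, so `D ^ (p - 1)` sends this preimage to `c *
  -- a⁻¹ * a = c`.
  refine ⟨c * ↑u⁻¹ * z ^ (p - 1), ?_⟩
  rw [hlin _ hc' _ _ (C.pow_mem hz _), ← ha, ← hu, mul_assoc, Units.inv_mul, mul_one]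

end HigherDerivation

/-! ### The group algebra acting on the coordinate algebra -/

section Translation

variable {K : Type*} [Field K] {H : Type*} [CommRing H] [Bialgebra K H]

/-- The action `x ↦ ∑ φ(x₁) x₂` of an element `φ` of the group algebra on the coordinate algebra. It
is the transpose of the left multiplication by `φ`. -/
noncomputable def GroupAlg.transl (φ : GroupAlg K H) : Module.End K H :=
  (TensorProduct.lid K H).toLinearMap ∘ₗ LinearMap.rTensor H φ.ofConv ∘ₗ Coalgebra.comul

namespace GroupAlg

theorem mul_apply_eq_transl (φ ψ : GroupAlg K H) (x : H) : (φ * ψ) x = ψ (transl φ x) := by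
  refine (LinearMap.convMul_apply φ ψ x).trans ?_
  change _ = ψ.ofConv (TensorProduct.lid K H (LinearMap.rTensor H φ.ofConv (Coalgebra.comul x)))
  generalize Coalgebra.comul (R := K) x = t
  induction t with
  | zero => simp
  | add a b ha hb => simp only [map_add, ha, hb]
  | tmul a b => simp

theorem eq_of_forall_apply_eq {x y : H} (h : ∀ φ : GroupAlg K H, φ x = φ y) : x = y := by
  rw [← sub_eq_zero, ← Module.forall_dual_apply_eq_zero_iff K]
  intro φ
  rw [map_sub, sub_eq_zero]
  exact h (toConv φ)

/-- The order reverses because `transl` is a transpose; associativity of convolution, tested against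
all functionals, gives the identity. -/
theorem transl_mul (φ ψ : GroupAlg K H) : transl (φ * ψ) = transl ψ * transl φ := by
  ext x
  refine eq_of_forall_apply_eq (K := K) fun η => ?_
  rw [Module.End.mul_apply, ← mul_apply_eq_transl, mul_assoc, mul_apply_eq_transl,
    mul_apply_eq_transl]

theorem transl_one : transl (1 : GroupAlg K H) = 1 := by
  ext x
  refine eq_of_forall_apply_eq (K := K) fun η => ?_
  rw [← mul_apply_eq_transl, one_mul, Module.End.one_apply]

theorem transl_zero : transl (0 : GroupAlg K H) = 0 := by
  ext x
  refine eq_of_forall_apply_eq (K := K) fun η => ?_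
  rw [← mul_apply_eq_transl, zero_mul, LinearMap.zero_apply]
  exact (map_zero η.ofConv).symm

theorem transl_pow (φ : GroupAlg K H) (n : ℕ) : transl (φ ^ n) = transl φ ^ n := by
  induction n with
  | zero => rw [pow_zero, pow_zero, transl_one]
  | succ n ih => rw [pow_succ, transl_mul, ih, pow_succ']

theorem counit_transl (φ : GroupAlg K H) (x : H) :
    Coalgebra.counit (R := K) (transl φ x) = φ x := by
  have h := mul_apply_eq_transl φ 1 x
  rw [mul_one] at h
  exact h.symm

theorem transl_apply_one (φ : GroupAlg K H) : transl φ 1 = φ 1 • (1 : H) := by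
  change TensorProduct.lid K H (LinearMap.rTensor H φ.ofConv (Coalgebra.comul 1)) = _
  rw [Bialgebra.comul_one, Algebra.TensorProduct.one_def, LinearMap.rTensor_tmul,
    TensorProduct.lid_tmul]

/-- Comultiplication is an algebra map, so a Leibniz rule for functionals, which concerns values at
the identity, passes to the translation operators. -/
theorem transl_leibniz (c : ℕ → GroupAlg K H) (n : ℕ)
    (hc : ∀ x y, c n (x * y) =
      ∑ z ∈ Finset.HasAntidiagonal.antidiagonal n, c z.1 x * c z.2 y) (x y : H) :
    transl (c n) (x * y) =
      ∑ z ∈ Finset.HasAntidiagonal.antidiagonal n, transl (c z.1) x * transl (c z.2) y := by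
  change TensorProduct.lid K H (LinearMap.rTensor H (c n).ofConv (Coalgebra.comul (x * y))) =
    ∑ z ∈ Finset.HasAntidiagonal.antidiagonal n,
      TensorProduct.lid K H (LinearMap.rTensor H (c z.1).ofConv (Coalgebra.comul x)) *
      TensorProduct.lid K H (LinearMap.rTensor H (c z.2).ofConv (Coalgebra.comul y))
  rw [Bialgebra.comul_mul]
  generalize Coalgebra.comul (R := K) x = s
  generalize Coalgebra.comul (R := K) y = t
  induction s with
  | zero => simp
  | add a b ha hb => simp only [map_add, add_mul, Finset.sum_add_distrib, ha, hb]
  | tmul a b =>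
    induction t with
    | zero => simp
    | add a b ha hb => simp only [map_add, mul_add, Finset.sum_add_distrib, ha, hb]
    | tmul a' b' =>
      simp only [Algebra.TensorProduct.tmul_mul_tmul, LinearMap.rTensor_tmul,
        TensorProduct.lid_tmul, smul_mul_smul_comm]
      rw [← Finset.sum_smul]
      exact congrArg (· • (b * b')) (hc a a')

/-- If `θ` acts freely on the coordinate algebra, then it acts freely on the group algebra. -/
theorem exists_eq_pow_mul {p : ℕ} (hp : 0 < p) {θ : GroupAlg K H}
    (h : LinearMap.ker (transl θ) ≤ LinearMap.range (transl θ ^ (p - 1))) {φ : GroupAlg K H}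
    (hφ : θ * φ = 0) : ∃ ψ, φ = θ ^ (p - 1) * ψ := by
  have h1 := ker_pow_le_range_pow h (Nat.sub_le p 1)
  rw [Nat.sub_sub_self hp, pow_one] at h1
  -- `θ * φ = 0` says that `φ` vanishes on the range of `transl θ`, which by `h1` contains the
  -- kernel of `transl θ ^ (p - 1)`. Hence `φ` factors through that power.
  have h2 : φ.ofConv ∈ LinearMap.range (transl θ ^ (p - 1)).dualMap := by
    rw [LinearMap.range_dualMap_eq_dualAnnihilator_ker, Submodule.mem_dualAnnihilator]
    intro x hx
    obtain ⟨y, rfl⟩ := h1 hx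
    refine (mul_apply_eq_transl θ φ y).symm.trans ?_
    rw [hφ]; rfl
  obtain ⟨ψ, hψ⟩ := h2
  refine ⟨toConv ψ, ofConv_injective (LinearMap.ext fun x => ?_)⟩
  rw [← hψ]
  change ψ ((transl θ ^ (p - 1)) x) = (θ ^ (p - 1) * toConv ψ) x
  rw [mul_apply_eq_transl, transl_pow]

end GroupAlg
end Translation

/-! ### The higher derivation of a one-parameter subgroup, and freeness on the coordinate algebra -/

section OneParameterAction

variable {k : Type*} [Field k] {p r : ℕ} [Fact p.Prime] [CharP k p]

theorem GaCoord.toConv_coeff_zero :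
    (toConv (GaCoord.coeff k p r 0) : GroupAlg k (GaCoord k p r)) = 1 := by
  have hq : 0 < p ^ r := pow_pos (Fact.out : p.Prime).pos r
  apply ofConv_injective
  apply LinearMap.ext
  intro x
  change GaCoord.coeff k p r 0 x = Coalgebra.counit (R := k) x
  rw [← GaCoord.sum_coeff k p r x, map_sum, map_sum]
  refine Finset.sum_congr rfl fun n _ => ?_
  rw [map_smul, map_smul, GaCoord.coeff_T_pow, Bialgebra.counit_pow, GaCoord.counit_T,
    zero_pow_eq]
  simp [hq]

namespace OneParam

variable {A : Type*} [CommRing A] [Bialgebra k A] {K : Type*} [Field K] [Algebra k K]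
  (μ : OneParam k p r A K)

/-- The image in `KG` of the functional dual to `T^j` under a one-parameter subgroup over `K`. -/
noncomputable def dualPow (j : ℕ) : GroupAlg K (K ⊗[k] A) :=
  GroupAlg.map μ (GroupAlg.baseChangeHom k K (GaCoord k p r) (toConv (GaCoord.coeff k p r j)))

theorem dualPow_apply (j : ℕ) (x : K ⊗[k] A) : dualPow μ j x = baseCoeff K j (μ x) := rfl

theorem dualPow_zero : dualPow μ 0 = 1 := by
  rw [dualPow, GaCoord.toConv_coeff_zero, map_one, map_one]

theorem dualPow_mul (i j : ℕ) :
    dualPow μ i * dualPow μ j = ((i + j).choose i : K) • dualPow μ (i + j) := by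
  rw [dualPow, dualPow, ← map_mul, ← map_mul, GaCoord.conv_coeff, map_smul,
    ← algebraMap_smul K, map_smul, map_natCast]
  rfl

theorem dualPow_commute (i j : ℕ) : dualPow μ i * dualPow μ j = dualPow μ j * dualPow μ i := by
  rw [dualPow_mul, dualPow_mul, add_comm j i, Nat.choose_symm_add]

/-- The comorphism is multiplicative, so this is the Cauchy product of coefficients; it holds only
below the truncation degree `p ^ r`. -/
theorem dualPow_leibniz {j : ℕ} (hj : j < p ^ r) (x y : K ⊗[k] A) :
    dualPow μ j (x * y) =
      ∑ z ∈ Finset.HasAntidiagonal.antidiagonal j, dualPow μ z.1 x * dualPow μ z.2 y := by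
  rw [dualPow_apply, map_mul, baseCoeff_mul hj]
  rfl

theorem dualPow_apply_one {j : ℕ} (hj : j < p ^ r) :
    dualPow μ j 1 = if j = 0 then 1 else 0 := by
  rw [dualPow_apply, map_one, Algebra.TensorProduct.one_def, baseCoeff_tmul,
    ← pow_zero (GaCoord.T k p r), GaCoord.coeff_T_pow]
  by_cases h : j = 0
  · subst h; simp [hj]
  · simp [h, Ne.symm h]

/-- If the functionals dual to `T^{p^l}` vanish for `l < i`, then so do the functionals dual to `T^a`
for all `a` not divisible by `p^i`. -/
theorem dualPow_eq_zero {i : ℕ} (h : ∀ l < i, dualPow μ (p ^ l) = 0) {a : ℕ} (ha : ¬ p ^ i ∣ a) :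
    dualPow μ a = 0 := by
  have ha0 : a ≠ 0 := fun h0 => ha (h0 ▸ dvd_zero _)
  -- With `p ^ l` the exact power of `p` in `a`, the functional at `a` is, up to the binomial
  -- `a.choose (p ^ l)`, a multiple of the one at `p ^ l`. That binomial is `m` modulo `p`, hence
  -- invertible.
  obtain ⟨l, m, hm, rfl⟩ := Nat.exists_eq_pow_mul_and_not_dvd ha0 p (Fact.out : p.Prime).ne_one
  have hl : l < i := by
    by_contra hl
    exact ha (Dvd.dvd.mul_right (pow_dvd_pow p (not_lt.1 hl)) m)
  have hm0 : 0 < m := Nat.pos_of_ne_zero fun h0 => hm (h0 ▸ dvd_zero _)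
  have hle : p ^ l ≤ p ^ l * m := Nat.le_mul_of_pos_right _ hm0
  have h1 := dualPow_mul μ (p ^ l) (p ^ l * m - p ^ l)
  rw [h l hl, zero_mul, Nat.add_sub_cancel' hle] at h1
  have hK : CharP K p := charP_of_injective_algebraMap (algebraMap k K).injective p
  refine (smul_eq_zero.1 h1.symm).resolve_left ?_
  rw [CharP.cast_eq_zero_iff K p,
    (choose_mul_pow_modEq p l m).dvd_iff dvd_rfl]
  exact hm

/-- The functional defining `θ` may itself lack Leibniz, and even vanish on the elements at hand;
the least `i` with nonzero image at `p ^ i` supplies an element `y`, and Frobenius powers of `y`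
carry its nonvanishing up to the level `p ^ (r - 1)` of `θ`. The criterion
`ker_le_range_pow_of_leibniz` then applies. -/
theorem ker_transl_theta_le (hε : ∀ x : K ⊗[k] A, Coalgebra.counit (R := K) x ≠ 0 → IsUnit x)
    (hμ : ∃ i < r, dualPow μ (p ^ i) ≠ 0) :
    LinearMap.ker (GroupAlg.transl μ.theta) ≤
      LinearMap.range (GroupAlg.transl μ.theta ^ (p - 1)) := by
  classical
  have hp := (Fact.out : p.Prime)
  have hK : CharP K p := charP_of_injective_algebraMap (algebraMap k K).injective p
  have hnt : Nontrivial (K ⊗[k] A) := (Bialgebra.counitAlgHom K (K ⊗[k] A)).toRingHom.domain_nontrivial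
  have hH : CharP (K ⊗[k] A) p :=
    charP_of_injective_algebraMap (algebraMap K (K ⊗[k] A)).injective p
  obtain ⟨hi, hi0⟩ := Nat.find_spec hμ
  set i := Nat.find hμ
  have hmin : ∀ l < i, dualPow μ (p ^ l) = 0 := fun l hl => by
    by_contra h
    exact Nat.find_min hμ hl ⟨hl.trans hi, h⟩
  obtain ⟨y₁, hy₁⟩ : ∃ y, dualPow μ (p ^ i) y ≠ 0 := by
    by_contra! h
    exact hi0 (ofConv_injective (LinearMap.ext h))
  have hpi : p ^ i < p ^ r := Nat.pow_lt_pow_right hp.one_lt hi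
  obtain ⟨y, hy0, hy⟩ : ∃ y : K ⊗[k] A, Coalgebra.counit (R := K) y = 0 ∧
      dualPow μ (p ^ i) y ≠ 0 := by
    -- Subtracting the constant term is harmless because the functional at `p ^ i > 0` kills `1`.
    refine ⟨y₁ - (Coalgebra.counit (R := K) y₁) • 1, ?_, ?_⟩
    · rw [map_sub, map_smul, Bialgebra.counit_one, smul_eq_mul, mul_one, sub_self]
    · change (dualPow μ (p ^ i)).ofConv _ ≠ 0
      rw [map_sub, map_smul]
      have : (dualPow μ (p ^ i)).ofConv 1 = 0 :=
        (dualPow_apply_one μ hpi).trans (if_neg (pow_ne_zero i hp.ne_zero))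
      rwa [this, smul_zero, sub_zero]
  set q := p ^ (r - 1) with hq
  have hq0 : 0 < q := pow_pos hp.pos _
  have hqr : q < p ^ r := Nat.pow_lt_pow_right hp.one_lt (by omega)
  let D : ℕ → Module.End K (K ⊗[k] A) := fun n => GroupAlg.transl (dualPow μ n)
  have hD : ∀ n < p ^ r, ∀ x y, D n (x * y) =
      ∑ z ∈ Finset.HasAntidiagonal.antidiagonal n, D z.1 x * D z.2 y := fun n hn =>
    GroupAlg.transl_leibniz (dualPow μ) n (dualPow_leibniz μ hn)
  have hD1 : ∀ n < p ^ r, D n 1 = if n = 0 then 1 else 0 := by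
    intro n hn
    change GroupAlg.transl (dualPow μ n) 1 = _
    rw [GroupAlg.transl_apply_one, dualPow_apply_one μ hn]
    split_ifs <;> simp
  have hD0 : D 0 = 1 := by
    change GroupAlg.transl (dualPow μ 0) = 1
    rw [dualPow_zero, GroupAlg.transl_one]
  have hDcomm : ∀ n x, D n (D q x) = D q (D n x) := by
    intro n x
    change (GroupAlg.transl (dualPow μ n) * GroupAlg.transl (dualPow μ q)) x =
      (GroupAlg.transl (dualPow μ q) * GroupAlg.transl (dualPow μ n)) x
    rw [← GroupAlg.transl_mul, ← GroupAlg.transl_mul, dualPow_commute]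
  -- Against these elements `D q` is a derivation: every mixed term of its Leibniz rule has an index
  -- strictly between `0` and `q`, hence not divisible by `q`. Commutativity of the `D n` makes `C`
  -- stable under `D q`.
  let C : Subring (K ⊗[k] A) :=
    { carrier := {x | ∀ n < p ^ r, ¬ q ∣ n → D n x = 0}
      mul_mem' := by
        intro x y hx hy n hn hqn
        rw [hD n hn]
        refine Finset.sum_eq_zero fun z hz => ?_
        rw [Finset.HasAntidiagonal.mem_antidiagonal] at hz
        by_cases h1 : q ∣ z.1
        · have h2 : ¬ q ∣ z.2 := fun h2 => hqn (hz ▸ dvd_add h1 h2)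
          rw [hy _ (by omega) h2, mul_zero]
        · rw [hx _ (by omega) h1, zero_mul]
      one_mem' := fun n hn hqn => by
        rw [hD1 n hn, if_neg]
        rintro rfl
        exact hqn (dvd_zero _)
      add_mem' := fun hx hy n hn hqn => by rw [map_add, hx n hn hqn, hy n hn hqn, add_zero]
      zero_mem' := fun n _ _ => map_zero _
      neg_mem' := fun hx n hn hqn => by rw [map_neg, hx n hn hqn, neg_zero] }
  have hqm : q = p ^ i * p ^ (r - 1 - i) := by
    rw [hq, ← pow_add]; congr 1; omega
  have hpm : 0 < p ^ (r - 1 - i) := pow_pos hp.pos _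
  have hDz : ∀ n < p ^ r, D n (y ^ p ^ (r - 1 - i)) = if p ^ (r - 1 - i) ∣ n then
      D (n / p ^ (r - 1 - i)) y ^ p ^ (r - 1 - i) else 0 := fun n hn =>
    leibniz_pow_char_pow p (fun n => D n) hD1 hD y _ hn
  refine ker_le_range_pow_of_leibniz p (Bialgebra.counitAlgHom K (K ⊗[k] A)) hε
    (GroupAlg.transl μ.theta) ?_ C ?_ ?_ (z := y ^ p ^ (r - 1 - i)) ?_ ?_ ?_
  · rw [← GroupAlg.transl_pow, theta_pow_p, GroupAlg.transl_zero]
  · intro x hx n hn hqn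
    refine (hDcomm n x).trans ?_
    rw [hx n hn hqn, map_zero]
  · intro b x hx
    refine (hD q hqr b x).trans ?_
    have hne : ((q, 0) : ℕ × ℕ) ≠ (0, q) := fun h => hq0.ne' (Prod.ext_iff.1 h).1
    rw [Finset.sum_eq_add (q, 0) (0, q) hne]
    · rw [hD0]; rfl
    · rintro ⟨s, t⟩ hz ⟨h1, h2⟩
      rw [Finset.HasAntidiagonal.mem_antidiagonal] at hz
      dsimp only at hz ⊢
      have ht0 : t ≠ 0 := by rintro rfl; exact h1 (by rw [← hz, add_zero])
      have htq : t ≠ q := by rintro rfl; exact h2 (by rw [Prod.mk.injEq]; exact ⟨by omega, rfl⟩)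
      rw [hx t (by omega) (Nat.not_dvd_of_pos_of_lt (by omega) (by omega)), mul_zero]
    · simp
    · simp
  · intro n hn hqn
    rw [hDz n hn]
    split_ifs with h
    · obtain ⟨m, rfl⟩ := h
      rw [Nat.mul_div_cancel_left _ hpm]
      -- Minimality of `i` enters here: `D m` can be nonzero only when `p ^ i ∣ m`, and then `q`
      -- would divide the original index.
      have hm : ¬ p ^ i ∣ m := fun h => hqn (by
        rw [hqm, mul_comm]; exact mul_dvd_mul_left _ h)
      change (GroupAlg.transl (dualPow μ m) y) ^ _ = 0
      rw [dualPow_eq_zero μ hmin hm, GroupAlg.transl_zero, LinearMap.zero_apply,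
        zero_pow hpm.ne']
    · rfl
  · rw [map_pow, Bialgebra.counitAlgHom_apply, hy0, zero_pow hpm.ne']
  · change Bialgebra.counitAlgHom K (K ⊗[k] A) (D q _) ≠ 0
    -- At index `q` the formula gives `D (p ^ i) y` to the power `p ^ (r - 1 - i)`, whose counit is
    -- a power of the nonzero value of the functional on `y`.
    rw [hDz q hqr, if_pos (hqm ▸ dvd_mul_left _ _), hqm, Nat.mul_div_cancel _ hpm, map_pow,
      Bialgebra.counitAlgHom_apply]
    change (Coalgebra.counit (R := K) (GroupAlg.transl (dualPow μ (p ^ i)) y)) ^ _ ≠ 0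
    rw [GroupAlg.counit_transl]
    exact pow_ne_zero _ hy

end OneParam

/-- The `p ^ r`-th power is additive, and each `a ∈ k[G]` differs from its counit by an element of
the maximal ideal, whose `p ^ r`-th power is zero. This is how the height bound survives extension
of scalars. -/
theorem baseChange_pow_eq {A : Type*} [CommRing A] [Bialgebra k A] [IsLocalRing A]
    (hA : ∀ x ∈ IsLocalRing.maximalIdeal A, x ^ p ^ r = 0)
    {K : Type*} [Field K] [Algebra k K] (x : K ⊗[k] A) :
    x ^ p ^ r = algebraMap K (K ⊗[k] A) (Coalgebra.counit (R := K) x) ^ p ^ r := by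
  have hp : (p : K ⊗[k] A) = 0 := by
    rw [← map_natCast (algebraMap k (K ⊗[k] A)), CharP.cast_eq_zero, map_zero]
  have hadd : ∀ x y : K ⊗[k] A, (x + y) ^ p ^ r = x ^ p ^ r + y ^ p ^ r := by
    intro x y
    obtain ⟨s, hs⟩ := exists_add_pow_prime_pow_eq (Fact.out : p.Prime) x y r
    rw [hs, hp]; simp
  induction x with
  | zero => simp
  | add x y hx hy => rw [hadd, map_add, map_add, hadd, hx, hy]
  | tmul c a =>
    obtain ⟨b, hb⟩ : ∃ b, a - algebraMap k A (Coalgebra.counit (R := k) a) = b := ⟨_, rfl⟩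
    have hbm : b ∈ IsLocalRing.maximalIdeal A := by
      rw [IsLocalRing.mem_maximalIdeal, mem_nonunits_iff]
      intro hu
      have h0 : Bialgebra.counitAlgHom k A b = 0 := by
        rw [← hb, map_sub, AlgHom.commutes]
        exact sub_self _
      exact (hu.map (Bialgebra.counitAlgHom k A)).ne_zero h0
    have h1 : c ⊗ₜ[k] a = algebraMap K (K ⊗[k] A) (Coalgebra.counit (R := K) (c ⊗ₜ[k] a)) +
        c ⊗ₜ[k] b := by
      rw [← hb, TensorProduct.tmul_sub, TensorProduct.counit_tmul, CommSemiring.counit_apply,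
        Algebra.TensorProduct.algebraMap_apply, Algebra.algebraMap_eq_smul_one (A := A),
        ← TensorProduct.smul_tmul]
      simp
    conv_lhs => rw [h1, hadd, Algebra.TensorProduct.tmul_pow, hA b hbm, TensorProduct.tmul_zero,
      add_zero]

/-- The `p ^ r`-th power of `x` is a nonzero scalar. -/
theorem isUnit_of_counit_ne_zero {A : Type*} [CommRing A] [Bialgebra k A] [IsLocalRing A]
    (hA : ∀ x ∈ IsLocalRing.maximalIdeal A, x ^ p ^ r = 0)
    {K : Type*} [Field K] [Algebra k K] (x : K ⊗[k] A) (hx : Coalgebra.counit (R := K) x ≠ 0) :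
    IsUnit x := by
  have h : IsUnit (x ^ p ^ r) := by
    rw [baseChange_pow_eq hA, ← map_pow]
    exact (IsUnit.mk0 _ (pow_ne_zero _ hx)).map _
  exact (isUnit_pow_iff (pow_ne_zero r (Fact.out : p.Prime).ne_zero)).1 h

end OneParameterAction

/-! ### From the regular module to projective modules -/

section Action

variable (k K : Type*) [Field k] [Field K] [Algebra k K] (A : Type*) [CommRing A] [Bialgebra k A]
  [Module.Finite k A]

namespace GroupAlg

instance : Module.Finite k (GroupAlg k A) :=
  Module.Finite.equiv (WithConv.linearEquiv k (A →ₗ[k] k)).symm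

variable {M N : Type*} [AddCommGroup M] [Module k M] [Module (GroupAlg k A) M]
  [IsScalarTower k (GroupAlg k A) M] [AddCommGroup N] [Module k N] [Module (GroupAlg k A) N]
  [IsScalarTower k (GroupAlg k A) N]

theorem act_tensorEquiv_tmul (c d : K) (s : GroupAlg k A) (m : M) :
    act k K A M (tensorEquiv k K A (c ⊗ₜ s)) (d ⊗ₜ m) = (c * d) ⊗ₜ (s • m) := by
  change LinearMap.tensorProductEnd k K M (Algebra.TensorProduct.map (AlgHom.id K K)
    (Algebra.lsmul k k M) ((tensorEquiv k K A).symm (tensorEquiv k K A (c ⊗ₜ s)))) (d ⊗ₜ m) = _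
  rw [AlgEquiv.symm_apply_apply]
  rfl

variable {k A} in
theorem baseChange_act (g : M →ₗ[GroupAlg k A] N) (φ : GroupAlg K (K ⊗[k] A)) (x : K ⊗[k] M) :
    (g.restrictScalars k).baseChange K (act k K A M φ x) =
      act k K A N φ ((g.restrictScalars k).baseChange K x) := by
  obtain ⟨t, rfl⟩ := (tensorEquiv k K A).surjective φ
  induction t with
  | zero => simp
  | add a b ha hb => simp only [map_add, LinearMap.add_apply, ha, hb]
  | tmul c s =>
    induction x with
    | zero => simp
    | add a b ha hb => simp only [map_add, ha, hb]
    | tmul d m =>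
      rw [act_tensorEquiv_tmul, LinearMap.baseChange_tmul, LinearMap.baseChange_tmul,
        act_tensorEquiv_tmul]
      simp

theorem tensorEquiv_tmul (c : K) (s : GroupAlg k A) :
    tensorEquiv k K A (c ⊗ₜ s) = c • baseChangeHom k K A s :=
  ofTensor_tmul k K A c s

/-- Identifies the base-changed regular module with left multiplication on `KG`, where freeness of
`θ` has been obtained. -/
theorem tensorEquiv_act (φ : GroupAlg K (K ⊗[k] A)) (x : K ⊗[k] GroupAlg k A) :
    tensorEquiv k K A (act k K A (GroupAlg k A) φ x) = φ * tensorEquiv k K A x := by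
  obtain ⟨t, rfl⟩ := (tensorEquiv k K A).surjective φ
  induction t with
  | zero => simp
  | add a b ha hb => simp only [map_add, LinearMap.add_apply, ha, hb, add_mul]
  | tmul c s =>
    induction x with
    | zero => simp
    | add a b ha hb => simp only [map_add, mul_add, ha, hb]
    | tmul d m =>
      rw [act_tensorEquiv_tmul, tensorEquiv_tmul, tensorEquiv_tmul, tensorEquiv_tmul,
        smul_mul_smul_comm, smul_eq_mul, map_mul]

variable {k K A}

theorem ker_act_le_of_regular {p : ℕ} {θ : GroupAlg K (K ⊗[k] A)}
    (h : ∀ φ, θ * φ = 0 → ∃ ψ, φ = θ ^ (p - 1) * ψ) :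
    LinearMap.ker (act k K A (GroupAlg k A) θ) ≤
      LinearMap.range (act k K A (GroupAlg k A) θ ^ (p - 1)) := by
  intro x hx
  rw [LinearMap.mem_ker] at hx
  have h1 := tensorEquiv_act k K A θ x
  rw [hx, map_zero] at h1
  obtain ⟨ψ, hψ⟩ := h _ h1.symm
  refine ⟨(tensorEquiv k K A).symm ψ, (tensorEquiv k K A).injective ?_⟩
  rw [← map_pow, tensorEquiv_act, AlgEquiv.apply_symm_apply, hψ]

/-- An element of `KG` acting freely on `KG` acts freely on the base change of a projective
`kG`-module. -/
theorem ker_act_le_of_projective {p : ℕ} {θ : GroupAlg K (K ⊗[k] A)}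
    (h : ∀ φ, θ * φ = 0 → ∃ ψ, φ = θ ^ (p - 1) * ψ) [Module.Finite (GroupAlg k A) M]
    [Module.Projective (GroupAlg k A) M] :
    LinearMap.ker (act k K A M θ) ≤ LinearMap.range (act k K A M θ ^ (p - 1)) := by
  -- `M` is a direct summand of `(kG)^n`. Its coordinate maps and inclusions commute with `θ` after
  -- base change, so preimages under `θ ^ (p - 1)` are found coordinatewise and summed.
  obtain ⟨n, f, g, -, -, hfg⟩ := Module.Finite.exists_comp_eq_id_of_projective (GroupAlg k A) M
  intro x hx
  rw [LinearMap.mem_ker] at hx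
  let pr (i : Fin n) : M →ₗ[GroupAlg k A] GroupAlg k A := LinearMap.proj i ∘ₗ g
  let inc (i : Fin n) : GroupAlg k A →ₗ[GroupAlg k A] M :=
    f ∘ₗ LinearMap.single (GroupAlg k A) (fun _ => GroupAlg k A) i
  have hsum : ∀ m, ∑ i, inc i (pr i m) = m := by
    intro m
    have := LinearMap.congr_fun hfg m
    rw [LinearMap.comp_apply, LinearMap.id_apply] at this
    conv_rhs => rw [← this, ← Finset.univ_sum_single (g m), map_sum]
    rfl
  have hsum' : ∑ i, ((inc i).restrictScalars k).baseChange K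
      (((pr i).restrictScalars k).baseChange K x) = x := by
    clear hx
    induction x with
    | zero => simp
    | add a b ha hb => simp only [map_add, Finset.sum_add_distrib, ha, hb]
    | tmul c m =>
      simp only [LinearMap.baseChange_tmul, LinearMap.restrictScalars_apply]
      rw [← TensorProduct.tmul_sum, hsum]
  have hpr : ∀ i, ∃ y, (act k K A (GroupAlg k A) θ ^ (p - 1)) y =
      ((pr i).restrictScalars k).baseChange K x := fun i => by
    refine ker_act_le_of_regular h ?_
    rw [LinearMap.mem_ker, ← baseChange_act, hx, map_zero]
  choose y hy using hpr
  refine ⟨∑ i, ((inc i).restrictScalars k).baseChange K (y i), ?_⟩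
  rw [map_sum]
  refine (Finset.sum_congr rfl fun i _ => ?_).trans hsum'
  rw [← hy, ← map_pow, ← map_pow, baseChange_act]

end GroupAlg
end Action

/-! ### Nonzero points of `V(G)` and the flip -/

section Points

variable {k : Type*} [Field k] {p r : ℕ} [Fact p.Prime] [CharP k p]
  {A : Type*} [CommRing A] [Bialgebra k A]

/-- If all these functionals die, so do those dual to every `T^j` with `0 < j < p ^ r`. Only the
constant coefficient, the counit, remains, so `μ_v` is trivial and `v` is the point `0`. -/
theorem V.exists_dualPow_ne_zero (v : V k p r A) (hv : v ≠ V.zero k p r A) :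
    ∃ i < r, OneParam.dualPow v.oneParam (p ^ i) ≠ 0 := by
  by_contra! h
  apply hv
  have hc : ∀ j < p ^ r, j ≠ 0 → OneParam.dualPow v.oneParam j = 0 := by
    intro j hj hj0
    refine OneParam.dualPow_eq_zero _ h fun hd => ?_
    exact hj.not_ge (Nat.le_of_dvd (Nat.pos_of_ne_zero hj0) hd)
  let f₀ : VCoord k p r A →ₐ[k] k := VCoord.homEquiv.symm (OneParam.trivial k p r A k)
  -- By representability it suffices to compare one-parameter subgroups; then `v`, the kernel of
  -- `v.eval`, is the kernel of `f₀`.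
  have heval : v.eval = (Algebra.ofId k v.ResidueField).comp f₀ := by
    apply VCoord.homEquiv.injective
    apply BialgHom.coe_toAlgHom_injective
    apply Algebra.TensorProduct.ext (by ext)
    ext a
    change VCoord.homEquiv v.eval (1 ⊗ₜ a) =
      VCoord.homEquiv ((Algebra.ofId k v.ResidueField).comp f₀) (1 ⊗ₜ a)
    have h0 : OneParam.baseCoeff v.ResidueField 0 (v.oneParam (1 ⊗ₜ a)) =
        Coalgebra.counit (R := v.ResidueField) ((1 : v.ResidueField) ⊗ₜ[k] a) := by
      rw [← OneParam.dualPow_apply, OneParam.dualPow_zero]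
      rfl
    rw [VCoord.homEquiv_comp, Equiv.apply_symm_apply]
    change v.oneParam (1 ⊗ₜ a) = _
    rw [← OneParam.sum_baseCoeff (v.oneParam (1 ⊗ₜ a)),
      Finset.sum_eq_single_of_mem 0 (Finset.mem_range.2 (pow_pos (Fact.out : p.Prime).pos r)), h0]
    · change _ = Algebra.TensorProduct.map _ _ (algebraMap k (k ⊗[k] GaCoord k p r)
        (Coalgebra.counit (R := k) ((1 : k) ⊗ₜ[k] a)))
      rw [AlgHom.commutes]
      simp [Algebra.algebraMap_eq_smul_one, Algebra.TensorProduct.one_def,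
        TensorProduct.smul_tmul']
    · intro j hj hj0
      rw [← OneParam.dualPow_apply, hc j (Finset.mem_range.1 hj) hj0]
      exact TensorProduct.zero_tmul _ _
  apply PrimeSpectrum.ext
  ext x
  have h1 : v.eval x = 0 ↔ x ∈ v.asIdeal := Ideal.algebraMap_residueField_eq_zero
  rw [← h1, heval]
  change algebraMap k v.ResidueField (f₀ x) = 0 ↔ f₀ x ∈ (⊥ : Ideal k)
  rw [map_eq_zero, Ideal.mem_bot]

theorem V.ker_thetaOp_le [Module.Finite k A] [IsLocalRing A]
    (hA : ∀ x ∈ IsLocalRing.maximalIdeal A, x ^ p ^ r = 0) (v : V k p r A)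
    (hv : v ≠ V.zero k p r A) (P : Type*) [AddCommGroup P] [Module k P] [Module (GroupAlg k A) P]
    [IsScalarTower k (GroupAlg k A) P] [Module.Finite (GroupAlg k A) P]
    [Module.Projective (GroupAlg k A) P] :
    LinearMap.ker (v.thetaOp P) ≤ LinearMap.range (v.thetaOp P ^ (p - 1)) :=
  GroupAlg.ker_act_le_of_projective fun _ hφ =>
    GroupAlg.exists_eq_pow_mul (Fact.out : p.Prime).pos
      (v.oneParam.ker_transl_theta_le (isUnit_of_counit_ne_zero hA) (v.exists_dualPow_ne_zero hv))
      hφ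

/-- The stable local Jordan types of the ends of a short exact sequence with projective middle term
are flips of each other away from `0`. -/
theorem stableLocalJordanType_eq_flip_of_exact [Module.Finite k A] [IsLocalRing A]
    (hA : ∀ x ∈ IsLocalRing.maximalIdeal A, x ^ p ^ r = 0) {v : V k p r A}
    (hv : v ≠ V.zero k p r A) {N P M : Type*}
    [AddCommGroup N] [Module k N] [Module (GroupAlg k A) N] [IsScalarTower k (GroupAlg k A) N]
    [AddCommGroup P] [Module k P] [Module (GroupAlg k A) P] [IsScalarTower k (GroupAlg k A) P]
    [AddCommGroup M] [Module k M] [Module (GroupAlg k A) M] [IsScalarTower k (GroupAlg k A) M]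
    [Module.Finite k M] [Module.Finite (GroupAlg k A) P] [Module.Projective (GroupAlg k A) P]
    {ι : N →ₗ[GroupAlg k A] P} {f : P →ₗ[GroupAlg k A] M} (hι : Function.Injective ι)
    (hf : Function.Surjective f) (hex : Function.Exact ι f) :
    stableLocalJordanType N v = flip (stableLocalJordanType M v) := by
  have hP : Module.Finite k P := Module.Finite.trans (GroupAlg k A) P
  have hN : Module.Finite k N := Module.Finite.of_injective (ι.restrictScalars k) hι
  have hex' : Function.Exact ((ι.restrictScalars k).baseChange v.ResidueField)
      ((f.restrictScalars k).baseChange v.ResidueField) :=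
    lTensor_exact v.ResidueField (f := ι.restrictScalars k) (g := f.restrictScalars k) hex hf
  have hinj : Function.Injective ((ι.restrictScalars k).baseChange v.ResidueField) :=
    Module.Flat.lTensor_preserves_injective_linearMap (M := v.ResidueField)
      (ι.restrictScalars k) hι
  have hsurj : Function.Surjective ((f.restrictScalars k).baseChange v.ResidueField) :=
    LinearMap.lTensor_surjective v.ResidueField (g := f.restrictScalars k) hf
  funext i
  refine HasJordanType.eq_of_exact (hasJordanType_localJordanType N v)
    (hasJordanType_localJordanType M v) hinj hsurj hex'
    (GroupAlg.baseChange_act v.ResidueField ι v.theta)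
    (GroupAlg.baseChange_act v.ResidueField f v.theta)
    (v.thetaOp_pow_p P) (v.ker_thetaOp_le hA hv P) ?_
  -- Reversal in `Fin (p - 1)` sends `i` to `p - 2 - i`, which is the index relation needed.
  simp only [Fin.val_castLE, Fin.val_rev]
  omega

end Points

/-- Lifts of finitely many generators of `M` span a submodule mapping onto `M`; by minimality it is
all of `P`. -/
theorem IsProjectiveCover.finite {R P M : Type*} [Ring R] [AddCommGroup P] [Module R P]
    [AddCommGroup M] [Module R M] [Module.Finite R M] {f : P →ₗ[R] M} (hf : IsProjectiveCover f) :
    Module.Finite R P := by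
  classical
  obtain ⟨s, hs⟩ := Module.Finite.fg_top (R := R) (M := M)
  choose g hg using hf.surjective
  refine ⟨⟨s.image g, hf.minimal _ ?_⟩⟩
  rw [Submodule.map_span, Finset.coe_image, ← Set.image_comp, ← hs]
  congr 1
  simp [hg]

end InfinitesimalGroup

theorem mainTheorem11 {k : Type*} [Field k] (p : ℕ) [Fact p.Prime] [CharP k p]
    {A : Type*} [CommRing A] [HopfAlgebra k A] [Module.Finite k A]
    [IsLocalRing A] (r : ℕ) (hr : 1 ≤ r)
    (hA : ∀ x ∈ IsLocalRing.maximalIdeal A, x ^ p ^ r = 0)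
    {M : Type*} [AddCommGroup M] [Module k M] [Module (InfinitesimalGroup.GroupAlg k A) M]
    [IsScalarTower k (InfinitesimalGroup.GroupAlg k A) M] [Module.Finite k M]
    {P : Type*} [AddCommGroup P] [Module k P] [Module (InfinitesimalGroup.GroupAlg k A) P]
    [IsScalarTower k (InfinitesimalGroup.GroupAlg k A) P]
    (f : P →ₗ[InfinitesimalGroup.GroupAlg k A] M) (hf : InfinitesimalGroup.IsProjectiveCover f)
    (v : InfinitesimalGroup.V k p r A) (hv : v ≠ InfinitesimalGroup.V.zero k p r A) :
    InfinitesimalGroup.stableLocalJordanType (LinearMap.ker f) v =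
      InfinitesimalGroup.flip (InfinitesimalGroup.stableLocalJordanType M v) := by
  have hMfin : Module.Finite (InfinitesimalGroup.GroupAlg k A) M :=
    Module.Finite.of_restrictScalars_finite k _ M
  have hPfin := hf.finite
  have hPproj := hf.projective
  exact InfinitesimalGroup.stableLocalJordanType_eq_flip_of_exact hA hv
    (LinearMap.ker f).injective_subtype hf.surjective f.exact_subtype_ker_map
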